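/- For real $a,b$, the matrix $D_G(a,b)=aA+b\overline{A}$ of a finite simple graph $G$ (with $A,\overline A$ the adjacency matrices of $G$ and of its complement) is *representable in* $\mathbb{R}^{p,q}$ if there is a map $\varphi:V\to\mathbb{R}^{p+q}$ with $\|\varphi(u)-\varphi(v)\|=D_G(a,b)_{uv}$ for all vertices $u,v$, where $\|x\|=\sum_{i=1}^p x_i^2-\sum_{j=1}^q x_{p+j}^2$. Switching $G$ with respect to $U\subset V$ reverses adjacency between $U$ and $V\setminus U$ and gives a graph $G^U$; the graphs $G^U$ form the switching class of $G$. The *minimum dimensionality* $d$ of the switching class is the least $p+q$ such that, for some $U$ and some $a\neq b$ with $D_{G^U}(a,b)\neq 0$, the matrix $D_{G^U}(a,b)$ is representable in $\mathbb{R}^{p,q}$. (The condition $D_{G^U}(a,b)\ne0$ follows from $a\ne b$ unless $G^U$ is edgeless or complete.) A *Delsarte clique* of a $k$-regular graph is a clique of size $1-k/\theta$, where $\theta$ is the smallest eigenvalue of $A$. Let $G=H(2,m)$, $m\ge 2$, be the graph on $V=X\times X$, $|X|=m$, in which two distinct vertices are adjacent iff they agree in exactly one coordinate. For $m\ge5$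 let $t_m=\frac m2\left(1-\sqrt{\frac{m-4}{m-2}}\right)$. Then the minimum dimensionality $d$ of the switching class of $G$, and all tuples $(U,a,b,p,q)$ with $U\subset V$, $|U|\le|V|/2$, $a\ne b$, $D_{G^U}(a,b)\ne0$, $p+q=d$ and $D_{G^U}(a,b)$ representable in $\mathbb{R}^{p,q}$, are as follows. Here $(a,b)$ is listed up to a common nonzero factor $c$; the listed $(p,q)$ belongs to $c>0$, and for $c<0$ it has to be replaced by $(q,p)$. 1. If $m=2$, then $d=1$; $(p,q)=(1,0)$, $(a,b)=(1,0)$, and $U$ is empty, one vertex, or two adjacent vertices. 2. If $m=3$, then $d=4$ and $(p,q)=(4,0)$; either $(a,b)=(1,2)$ and $U$ is empty or a Delsarte clique, or $(a,b)=(2,1)$ and $U$ is empty or a coclique on $3$ vertices. 3. If $m=4$, then $d=5$; $(p,q)=(5,0)$, $(a,b)=(1,2)$, and $U$ is the union of two disjoint Delsarte cliques ($|U|=2m$). 4. If $m\ge5$, then $d=2m-2$; $(a,b)=(1,2)$, and $U$ is the union of $s$ pairwise disjoint Delsarte cliques ($|U|=sm$) for some $0\le s\le\lfloor m/2\rfloor$.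 Here $(p,q)=(2m-2,0)$ if $s<t_m$ and $(p,q)=(2m-3,1)$ if $s>t_m$. Such $U$ exist for every $0\le s\le\lfloor m/2\rfloor$, one has $0<t_m<\lfloor m/2\rfloor$ (so both signatures occur), and $t_m$ is not an integer. -/

import Mathlib

noncomputable section

namespace PseudoEuclidean

/-- The underlying vector space of `ℝ^{p,q}`: `p` coordinates of positive sign, followed by `q`
coordinates of negative sign. -/
abbrev Space (p q : ℕ) : Type := Fin p ⊕ Fin q → ℝ

/-- The bilinear form `⟪⟪x, y⟫⟫ = x₁y₁ + ⋯ + x_p y_p - x_{p+1}y_{p+1} - ⋯ - x_{p+q}y_{p+q}`. -/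
def form {p q : ℕ} (x y : Space p q) : ℝ :=
  ∑ i : Fin p, x (Sum.inl i) * y (Sum.inl i) - ∑ j : Fin q, x (Sum.inr j) * y (Sum.inr j)

/-- The scalar square `‖x‖ = ⟪⟪x, x⟫⟫`, which may be zero or negative for `x ≠ 0`. -/
def scalarSquare {p q : ℕ} (x : Space p q) : ℝ := form x x

open Classical in
/-- The dissimilarity matrix `D(a,b) = a A + b Ā`, with `A` the adjacency matrix of `G` and `Ā` that
of its complement. -/
def dissimilarity {V : Type*} (G : SimpleGraph V) (a b : ℝ) : Matrix V V ℝ :=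
  a • G.adjMatrix ℝ + b • Gᶜ.adjMatrix ℝ

/-- `φ` represents `D(a,b)` on the graph `G` in `ℝ^{p,q}`: the scalar square of
`φ u - φ v` is `a` on edges, `b` on non-edges, and `0` if `u = v`. -/
def IsRepresentation {V : Type*} (G : SimpleGraph V) (a b : ℝ) {p q : ℕ}
    (φ : V → Space p q) : Prop :=
  ∀ u v : V, scalarSquare (φ u - φ v) = dissimilarity G a b u v

/-- `D(a,b)` on `G` is representable in `ℝ^{p,q}`. -/
def Representable {V : Type*} (G : SimpleGraph V) (a b : ℝ) (p q : ℕ) : Prop :=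
  ∃ φ : V → Space p q, IsRepresentation G a b φ

/-- Seidel switching of `G` with respect to `U`: adjacency is kept inside `U` and inside the
complement of `U`, and reversed between `U` and its complement. -/
def switching {V : Type*} (G : SimpleGraph V) (U : Finset V) : SimpleGraph V where
  Adj u v := ((u ∈ U ↔ v ∈ U) ∧ G.Adj u v) ∨ (¬(u ∈ U ↔ v ∈ U) ∧ ¬G.Adj u v)
  symm := ⟨by
    intro u v h
    rcases h with ⟨h1, h2⟩ | ⟨h1, h2⟩
    · exact Or.inl ⟨h1.symm, h2.symm⟩
    · exact Or.inr ⟨fun h => h1 h.symm, fun h => h2 h.symm⟩⟩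
  loopless := ⟨by
    intro u h
    rcases h with ⟨_, h2⟩ | ⟨h1, _⟩
    · exact G.irrefl h2
    · exact h1 Iff.rfl⟩

/-- The switching class of a graph on a finite vertex set. -/
def switchingClass {V : Type*} (G : SimpleGraph V) : Set (SimpleGraph V) :=
  Set.range (switching G)

/-- The distances `a, b` on `G` are admissible: `a ≠ b`, and `D(a,b)` is not the zero matrix.
For a graph that has both an edge and a non-edge, the second condition follows from the first; it
excludes the map of an edgeless graph (with `b = 0`) or of a complete graph (with `a = 0`) to a
single point. -/
def Admissible {V : Type*} (G : SimpleGraph V) (a b : ℝ) : Prop :=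
  a ≠ b ∧ dissimilarity G a b ≠ 0

/-- `d` is the minimum dimensionality of the switching class of `G`: the least value of `p + q` such
that some graph in the switching class has a representation in `ℝ^{p,q}` with
admissible distances. -/
def IsMinDimensionality {V : Type*} (G : SimpleGraph V) (d : ℕ) : Prop :=
  IsLeast {n : ℕ | ∃ H ∈ switchingClass G, ∃ (a b : ℝ) (p q : ℕ),
    Admissible H a b ∧ Representable H a b p q ∧ p + q = n} d

/-- The graph obtained from `G` by switching with respect to `U` has, with the distances
`a, b`, a representation in `ℝ^{p,q}`, and `p + q` is the minimum dimensionality of the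
switching class of `G`. -/
def Attains {V : Type*} (G : SimpleGraph V) (U : Finset V) (a b : ℝ) (p q : ℕ) : Prop :=
  Admissible (switching G U) a b ∧ Representable (switching G U) a b p q ∧
    IsMinDimensionality G (p + q)

/-- The distances `a, b` in `ℝ^{p,q}` are, up to scaling, the distances `a₀, b₀` in
`ℝ^{p₀,q₀}`. Multiplying the distances by a negative number turns `ℝ^{p₀,q₀}`
into `ℝ^{q₀,p₀}`. -/
def UpToScaling (a b : ℝ) (p q : ℕ) (a₀ b₀ : ℝ) (p₀ q₀ : ℕ) : Prop :=
  ∃ c : ℝ, a = c * a₀ ∧ b = c * b₀ ∧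
    ((0 < c ∧ p = p₀ ∧ q = q₀) ∨ (c < 0 ∧ p = q₀ ∧ q = p₀))

/-- The Hamming graph `H(2,m)` on `X × X`, where `X` has `m` elements. -/
def hamming (X : Type*) : SimpleGraph (X × X) where
  Adj u v := (u.1 = v.1 ∧ u.2 ≠ v.2) ∨ (u.1 ≠ v.1 ∧ u.2 = v.2)
  symm := ⟨by
    intro u v h
    rcases h with ⟨h1, h2⟩ | ⟨h1, h2⟩
    · exact Or.inl ⟨h1.symm, h2.symm⟩
    · exact Or.inr ⟨h1.symm, h2.symm⟩⟩
  loopless := ⟨by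
    intro u h
    rcases h with ⟨_, h2⟩ | ⟨h1, _⟩
    · exact h2 rfl
    · exact h1 rfl⟩

open Classical in
/-- A Delsarte clique of a `k`-regular graph: a clique `C` that attains the bound
`|C| ≤ 1 - k / θ`, where `θ` is the smallest eigenvalue of the adjacency matrix. -/
def IsDelsarteClique {V : Type*} [Fintype V] (G : SimpleGraph V) (C : Finset V) : Prop :=
  G.IsClique (C : Set V) ∧ ∃ (k : ℕ) (θ : ℝ), G.IsRegularOfDegree k ∧
    IsLeast (spectrum ℝ (G.adjMatrix ℝ)) θ ∧ (C.card : ℝ) = 1 - (k : ℝ) / θ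

/-- `U` is the union of `s` pairwise disjoint Delsarte cliques of `G`. -/
def IsDisjointUnionOfDelsarteCliques {V : Type*} [Fintype V] (G : SimpleGraph V) (s : ℕ)
    (U : Finset V) : Prop :=
  ∃ 𝒞 : Finset (Finset V), 𝒞.card = s ∧ (∀ C ∈ 𝒞, IsDelsarteClique G C) ∧
    (𝒞 : Set (Finset V)).PairwiseDisjoint id ∧ ∀ v : V, v ∈ U ↔ ∃ C ∈ 𝒞, v ∈ C

/-- The threshold `t_m = (m/2) (1 - √((m-4)/(m-2)))`, used for `m ≥ 5` only. -/
def threshold (m : ℕ) : ℝ :=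
  (m : ℝ) / 2 * (1 - Real.sqrt (((m : ℝ) - 4) / ((m : ℝ) - 2)))

end PseudoEuclidean

end

/-!
Fix a set `U` with `±1`-vector `ε` (equal to `-1` on `U`) and let `S` be the Seidel matrix of `G`,
with entries `-1` on edges and `1` on non-edges. Switching with respect to `U` replaces `S` by
`diag(ε) S diag(ε)`. If `φ` represents `D(a,b)` on the switched graph in `ℝ^{p,q}`, then the linear
map `y ↦ ∑ ε_u y_u φ u` (`repMap`) pulls the form of `ℝ^{p,q}` back, on the hyperplane `ε^⊥`
(`signPerp`), to a quarter of the form of the matrix `(a + b) I + (a - b) S` (`distOp`,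
`form_repMap`), which depends on `U` only through the hyperplane. Hence `p + q` is at least the
rank of that form on `ε^⊥`, that is, `|V| - 1` minus the dimension of its radical (`rad`); subspaces
of `ε^⊥` on which the form is nonnegative bound `p` from below, and a negative vector
forces `q > 0`. Conversely, the spectral theorem gives a representation whose dimension is the rank
(`exists_representable`). So the minimum dimensionality asks for the largest radical.

Two facts control the radicals. Radicals for non-proportional pairs `(a,b)` are orthogonal to each
other inside `ε^⊥`, so at most one of them can be large. And if `ε` is not orthogonal to the kernel
of `distOp G a b` on the whole space, then the radical is strictly smaller than this kernel
(`finrank_rad_lt`).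

For `G = H(2,m)` the form for the distances `1, 2` is `2 ∑ r_i² + 2 ∑ c_j² - t²`, with `r`, `c`, `t`
the row sums, column sums and total of `y`. Its kernel consists of the functions with zero row and
column sums, of dimension `(m-1)²`, together with the constants if `m = 4`. A `±1`-vector is
orthogonal to these functions only if `U` is a union of parallel lines (`exists_isUnionOfLines`),
and for the union of `s` lines, with `k = m - 2 s`, the form on `ε^⊥` is nonnegative if
`m² (m - 4) ≤ (m - 2) k²` and takes negative values otherwise; its radical exceeds the kernel only
in the case of equality with `k ≠ 0` (`rad_rows_le`, `nonneg_rows`, `exists_neg_rows`). Equality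
would make `(m - 2) (m - 4) = (m - 3)² - 1` a square, which is impossible for `m ≥ 5`; this is
also why the threshold is not an integer. The lines are the Delsarte cliques, as the valency is
`2 (m - 1)` and the smallest eigenvalue is `-2`.

For `m = 3` the graph is self-complementary, which turns the distances `1, 2` into `2, 1`; the two
radicals together leave no room for a third one of the same size. For `m = 2` the switching class
consists of the complete bipartite graphs, which embed in the line, and the edgeless graph.
-/

noncomputable section

namespace PseudoEuclidean

open Matrix Module

section

variable {V : Type*}

/-! ### Linear algebra of the pseudo-Euclidean form -/

/-- The form of `ℝ^{p,q}` as a bilinear map. -/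
def formB (p q : ℕ) : LinearMap.BilinForm ℝ (Space p q) :=
  LinearMap.mk₂ ℝ (fun x y => form x y)
    (by intro x x' y; simp only [form, Pi.add_apply, add_mul, Finset.sum_add_distrib]; ring)
    (by
      intro c x y
      simp only [form, Pi.smul_apply, smul_eq_mul, mul_assoc, ← Finset.mul_sum]; ring)
    (by intro x y y'; simp only [form, Pi.add_apply, mul_add, Finset.sum_add_distrib]; ring)
    (by
      intro c x y
      simp only [form, Pi.smul_apply, smul_eq_mul, mul_left_comm _ c, ← Finset.mul_sum]; ring)

@[simp]
theorem formB_apply {p q : ℕ} (x y : Space p q) : formB p q x y = form x y := rfl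

theorem form_comm {p q : ℕ} (x y : Space p q) : form x y = form y x := by
  simp only [form, mul_comm]

theorem form_sum_smul {p q : ℕ} [Fintype V] (φ : V → Space p q) (c d : V → ℝ) :
    form (∑ u, c u • φ u) (∑ v, d v • φ v) = ∑ u, ∑ v, c u * d v * form (φ u) (φ v) := by
  rw [← formB_apply]
  simp only [map_sum, map_smul, LinearMap.sum_apply, LinearMap.smul_apply, formB_apply, smul_eq_mul,
    Finset.mul_sum]
  rw [Finset.sum_comm]
  exact Finset.sum_congr rfl fun u _ => Finset.sum_congr rfl fun v _ => by ring

theorem scalarSquare_sub {p q : ℕ} (x y : Space p q) :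
    scalarSquare (x - y) = form x x + form y y - 2 * form x y := by
  have h : scalarSquare (x - y) = formB p q (x - y) (x - y) := rfl
  rw [h]
  simp only [map_sub, LinearMap.sub_apply, formB_apply, form_comm y x]
  ring

theorem scalarSquare_smul {p q : ℕ} (c : ℝ) (x : Space p q) :
    scalarSquare (c • x) = c * c * scalarSquare x := by
  have h : scalarSquare (c • x) = formB p q (c • x) (c • x) := rfl
  rw [h]
  simp only [map_smul, LinearMap.smul_apply, formB_apply, smul_eq_mul, scalarSquare]
  ring

/-- A real symmetric matrix is a Gram matrix in a space `ℝ^{p,q}` whose dimension is its rank. -/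
theorem exists_gram [Fintype V] (K : Matrix V V ℝ) (hK : K.IsSymm) :
    ∃ (p q : ℕ) (φ : V → Space p q), p + q = K.rank ∧ ∀ u v, form (φ u) (φ v) = K u v := by
  classical
  have hH : K.IsHermitian := by
    rw [Matrix.IsHermitian, conjTranspose_eq_transpose_of_trivial]; exact hK
  set l := hH.eigenvalues with hl
  have key : ∀ u v, K u v = ∑ i, l i * (hH.eigenvectorBasis i u * hH.eigenvectorBasis i v) := by
    intro u v
    have h := hH.spectral_theorem
    have h2 := congrFun (congrFun h u) v
    rw [h2, Unitary.conjStarAlgAut_apply, Matrix.mul_apply]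
    refine Finset.sum_congr rfl fun i _ => ?_
    rw [Matrix.mul_diagonal]
    simp only [hH.eigenvectorUnitary_apply, Matrix.star_apply, Function.comp_apply, star_trivial,
      RCLike.ofReal_real_eq_id, id_eq, hl]
    ring
  let P := {i // 0 < l i}
  let N := {i // l i < 0}
  let eP := Fintype.equivFin P
  let eN := Fintype.equivFin N
  refine ⟨Fintype.card P, Fintype.card N, fun u => Sum.elim
    (fun i => √(l (eP.symm i)) * hH.eigenvectorBasis (eP.symm i) u)
    (fun i => √(-l (eN.symm i)) * hH.eigenvectorBasis (eN.symm i) u), ?_, ?_⟩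
  · rw [hH.rank_eq_card_non_zero_eigs, ← Fintype.card_sum]
    have hdis : Disjoint (fun i => 0 < l i) (fun i => l i < 0) := by
      rw [Pi.disjoint_iff]
      intro i
      rw [Prop.disjoint_iff]
      rcases le_or_gt (l i) 0 with h | h
      · exact fun h' => absurd h'.1 (not_lt.mpr h)
      · exact fun h' => absurd h'.2 (not_lt.mpr h.le)
    rw [Fintype.card_sum, ← Fintype.card_subtype_or_disjoint _ _ hdis]
    refine Fintype.card_congr (Equiv.subtypeEquivRight fun i => ?_)
    rw [or_comm]
    exact lt_or_lt_iff_ne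
  · intro u v
    rw [key]
    simp only [form, Sum.elim_inl, Sum.elim_inr]
    rw [eP.symm.sum_comp (fun i : P => √(l i) * hH.eigenvectorBasis i u *
      (√(l i) * hH.eigenvectorBasis i v)),
      eN.symm.sum_comp (fun i : N => √(-l i) * hH.eigenvectorBasis i u *
      (√(-l i) * hH.eigenvectorBasis i v))]
    have h1 : ∑ i : P, √(l i) * hH.eigenvectorBasis i u * (√(l i) * hH.eigenvectorBasis i v)
        = ∑ i, if 0 < l i then l i * (hH.eigenvectorBasis i u * hH.eigenvectorBasis i v)
          else 0 := by
      rw [← Finset.sum_filter, ← Finset.sum_subtype_eq_sum_filter]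
      simp only [Finset.subtype_univ]
      refine Finset.sum_congr rfl fun i _ => ?_
      have := Real.mul_self_sqrt i.2.le
      linear_combination (hH.eigenvectorBasis i u * hH.eigenvectorBasis i v) * this
    have h2 : ∑ i : N, √(-l i) * hH.eigenvectorBasis i u * (√(-l i) * hH.eigenvectorBasis i v)
        = ∑ i, if l i < 0 then -l i * (hH.eigenvectorBasis i u * hH.eigenvectorBasis i v)
          else 0 := by
      rw [← Finset.sum_filter, ← Finset.sum_subtype_eq_sum_filter]
      simp only [Finset.subtype_univ]
      refine Finset.sum_congr rfl fun i _ => ?_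
      have := Real.mul_self_sqrt (neg_nonneg.mpr i.2.le)
      linear_combination (hH.eigenvectorBasis i u * hH.eigenvectorBasis i v) * this
    rw [h1, h2, ← Finset.sum_sub_distrib]
    refine Finset.sum_congr rfl fun i _ => ?_
    rcases lt_trichotomy (l i) 0 with h | h | h
    · simp [h, h.le]
    · simp [h]
    · simp [h, h.le]

/-! ### Scaling and transport of representations -/

theorem dissimilarity_of_adj {G : SimpleGraph V} (a b : ℝ) {u v : V} (h : G.Adj u v) :
    dissimilarity G a b u v = a := by
  simp [dissimilarity, h, h.ne]

theorem dissimilarity_of_not_adj {G : SimpleGraph V} (a b : ℝ) {u v : V} (hne : u ≠ v)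
    (h : ¬G.Adj u v) : dissimilarity G a b u v = b := by
  simp [dissimilarity, h, hne]

theorem dissimilarity_self (G : SimpleGraph V) (a b : ℝ) (u : V) :
    dissimilarity G a b u u = 0 := by
  simp [dissimilarity]

open Classical in
theorem dissimilarity_apply (G : SimpleGraph V) (a b : ℝ) (u v : V) :
    dissimilarity G a b u v = if u = v then 0 else if G.Adj u v then a else b := by
  split_ifs with h1 h2
  · rw [h1, dissimilarity_self]
  · exact dissimilarity_of_adj a b h2
  · exact dissimilarity_of_not_adj a b h1 h2

theorem switching_adj {G : SimpleGraph V} {U : Finset V} {u v : V} :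
    (switching G U).Adj u v ↔ ((u ∈ U ↔ v ∈ U) ∧ G.Adj u v) ∨ (¬(u ∈ U ↔ v ∈ U) ∧ ¬G.Adj u v) :=
  Iff.rfl

theorem dissimilarity_mul (G : SimpleGraph V) (a b c : ℝ) (u v : V) :
    dissimilarity G (c * a) (c * b) u v = c * dissimilarity G a b u v := by
  simp [dissimilarity, mul_add]

theorem Representable.mul_of_pos {G : SimpleGraph V} {a b : ℝ} {p q : ℕ}
    (h : Representable G a b p q) {c : ℝ} (hc : 0 < c) :
    Representable G (c * a) (c * b) p q := by
  obtain ⟨φ, hφ⟩ := h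
  refine ⟨fun v => √c • φ v, fun u v => ?_⟩
  rw [← smul_sub, scalarSquare_smul, Real.mul_self_sqrt hc.le, hφ, dissimilarity_mul]

theorem Representable.neg {G : SimpleGraph V} {a b : ℝ} {p q : ℕ}
    (h : Representable G a b p q) : Representable G (-a) (-b) q p := by
  obtain ⟨φ, hφ⟩ := h
  refine ⟨fun v => φ v ∘ Sum.swap, fun u v => ?_⟩
  have h1 := dissimilarity_mul G a b (-1) u v
  simp only [neg_one_mul] at h1
  rw [h1, ← hφ]
  simp [scalarSquare, form]

theorem Representable.mul_of_neg {G : SimpleGraph V} {a b : ℝ} {p q : ℕ}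
    (h : Representable G a b p q) {c : ℝ} (hc : c < 0) :
    Representable G (c * a) (c * b) q p := by
  have := h.neg.mul_of_pos (neg_pos.mpr hc)
  simpa using this

/-- A representation with distances proportional to `a₀, b₀` rescales to one with distances
`a₀, b₀`, up to exchanging the two parts of the signature. -/
theorem Representable.of_mul {G : SimpleGraph V} {a₀ b₀ c : ℝ} {p q : ℕ} (hc : c ≠ 0)
    (h : Representable G (c * a₀) (c * b₀) p q) :
    ∃ p₀ q₀, p₀ + q₀ = p + q ∧ Representable G a₀ b₀ p₀ q₀ ∧
      UpToScaling (c * a₀) (c * b₀) p q a₀ b₀ p₀ q₀ := by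
  have e : ∀ x : ℝ, c⁻¹ * (c * x) = x := fun x => inv_mul_cancel_left₀ hc x
  rcases hc.lt_or_gt with hc | hc
  · refine ⟨q, p, add_comm _ _, ?_, c, rfl, rfl, Or.inr ⟨hc, rfl, rfl⟩⟩
    simpa only [e] using h.mul_of_neg (inv_lt_zero.mpr hc)
  · refine ⟨p, q, rfl, ?_, c, rfl, rfl, Or.inl ⟨hc, rfl, rfl⟩⟩
    simpa only [e] using h.mul_of_pos (inv_pos.mpr hc)

theorem Representable.of_upToScaling {G : SimpleGraph V} {a b a₀ b₀ : ℝ} {p q p₀ q₀ : ℕ}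
    (h : Representable G a₀ b₀ p₀ q₀) (hs : UpToScaling a b p q a₀ b₀ p₀ q₀) :
    Representable G a b p q := by
  obtain ⟨c, rfl, rfl, ⟨hc, rfl, rfl⟩ | ⟨hc, rfl, rfl⟩⟩ := hs
  · exact h.mul_of_pos hc
  · exact h.mul_of_neg hc

theorem UpToScaling.add_eq {a b a₀ b₀ : ℝ} {p q p₀ q₀ : ℕ}
    (hs : UpToScaling a b p q a₀ b₀ p₀ q₀) : p + q = p₀ + q₀ := by
  obtain ⟨c, -, -, ⟨-, rfl, rfl⟩ | ⟨-, rfl, rfl⟩⟩ := hs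
  · rfl
  · exact add_comm _ _

theorem Admissible.of_upToScaling {G : SimpleGraph V} {a b a₀ b₀ : ℝ} {p q p₀ q₀ : ℕ}
    (h : Admissible G a₀ b₀) (hs : UpToScaling a b p q a₀ b₀ p₀ q₀) : Admissible G a b := by
  obtain ⟨c, rfl, rfl, hc⟩ := hs
  have hc : c ≠ 0 := by
    rcases hc with hc | hc
    · exact hc.1.ne'
    · exact hc.1.ne
  refine ⟨fun e => h.1 (mul_left_cancel₀ hc e), fun e => h.2 ?_⟩
  ext u v
  have := congrFun (congrFun e u) v
  rw [dissimilarity_mul] at this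
  exact (mul_eq_zero.mp this).resolve_left hc

theorem admissible_of_ne_zero [Nontrivial V] (G : SimpleGraph V) {a b : ℝ} (hab : a ≠ b)
    (ha : a ≠ 0) (hb : b ≠ 0) : Admissible G a b := by
  refine ⟨hab, fun e => ?_⟩
  obtain ⟨u, v, huv⟩ := exists_pair_ne V
  have := congrFun (congrFun e u) v
  by_cases h : G.Adj u v
  · rw [dissimilarity_of_adj a b h] at this
    exact ha this
  · rw [dissimilarity_of_not_adj a b huv h] at this
    exact hb this

theorem Representable.map_automorphism {G : SimpleGraph V} (e : V ≃ V)
    (he : ∀ u v, G.Adj (e u) (e v) ↔ G.Adj u v) {U : Finset V} {a b : ℝ} {p q : ℕ}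
    (h : Representable (switching G (U.map e.toEmbedding)) a b p q) :
    Representable (switching G U) a b p q := by
  obtain ⟨φ, hφ⟩ := h
  refine ⟨φ ∘ e, fun u v => ?_⟩
  have hm : ∀ w, e w ∈ U.map e.toEmbedding ↔ w ∈ U := fun w => by simp
  have h1 := hφ (e u) (e v)
  simp only [Function.comp_apply]
  rw [h1]
  classical
  simp only [dissimilarity_apply, switching_adj, he, hm, e.apply_eq_iff_eq]

/-- An isomorphism of `G` with its complement exchanges the two distances. -/
theorem Representable.map_antiautomorphism {G : SimpleGraph V} (e : V ≃ V)
    (he : ∀ u v, u ≠ v → (G.Adj (e u) (e v) ↔ ¬G.Adj u v)) {U : Finset V} {a b : ℝ} {p q : ℕ}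
    (h : Representable (switching G (U.map e.toEmbedding)) a b p q) :
    Representable (switching G U) b a p q := by
  obtain ⟨φ, hφ⟩ := h
  refine ⟨φ ∘ e, fun u v => ?_⟩
  have hm : ∀ w, e w ∈ U.map e.toEmbedding ↔ w ∈ U := fun w => by simp
  have h1 := hφ (e u) (e v)
  simp only [Function.comp_apply]
  rw [h1]
  by_cases huv : u = v
  · subst huv; simp only [dissimilarity_self]
  · have : (switching G (U.map e.toEmbedding)).Adj (e u) (e v) ↔ ¬(switching G U).Adj u v := by
      simp only [switching_adj, hm, he u v huv]
      tauto
    by_cases hA : (switching G U).Adj u v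
    · rw [dissimilarity_of_adj b a hA,
        dissimilarity_of_not_adj a b (e.injective.ne huv) (fun h => this.mp h hA)]
    · rw [dissimilarity_of_not_adj b a huv hA, dissimilarity_of_adj a b (this.mpr hA)]

/-! ### The radical of a switched dissimilarity form -/

open Classical in
/-- The `±1`-vector of a set `U`, equal to `-1` on `U`. -/
def signVec (U : Finset V) (u : V) : ℝ := if u ∈ U then -1 else 1

theorem signVec_mul_self (U : Finset V) (u : V) : signVec U u * signVec U u = 1 := by
  unfold signVec; split_ifs <;> norm_num

theorem signVec_ne_zero (U : Finset V) (u : V) : signVec U u ≠ 0 := by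
  unfold signVec; split_ifs <;> norm_num

open Classical in
/-- The Seidel matrix: `0` on the diagonal, `-1` on edges and `1` on non-edges. -/
def seidel (G : SimpleGraph V) : Matrix V V ℝ :=
  Matrix.of fun u v => if u = v then 0 else if G.Adj u v then -1 else 1

theorem seidel_comm (G : SimpleGraph V) (u v : V) : seidel G u v = seidel G v u := by
  classical
  simp [seidel, eq_comm (a := u), G.adj_comm u]

open Classical in
theorem dissimilarity_switching (G : SimpleGraph V) (U : Finset V) (a b : ℝ) (u v : V) :
    dissimilarity (switching G U) a b u v =
      (a + b) / 2 * (1 - if u = v then 1 else 0) -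
        (a - b) / 2 * (signVec U u * signVec U v * seidel G u v) := by
  rw [dissimilarity_apply]
  by_cases huv : u = v
  · subst huv; simp [seidel]
  · by_cases hA : G.Adj u v <;> by_cases hu : u ∈ U <;> by_cases hv : v ∈ U <;>
      simp [switching_adj, seidel, signVec, huv, hA, hu, hv] <;> ring

variable [Fintype V]

/-- The vectors orthogonal to the `±1`-vector of `U`. -/
def signPerp (U : Finset V) : Submodule ℝ (V → ℝ) where
  carrier := {y | ∑ u, signVec U u * y u = 0}
  add_mem' {x y} hx hy := by
    simp only [Set.mem_ofPred_eq, Pi.add_apply, mul_add, Finset.sum_add_distrib] at *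
    linarith
  zero_mem' := by simp
  smul_mem' c x hx := by
    simp only [Set.mem_ofPred_eq, Pi.smul_apply, smul_eq_mul, mul_left_comm _ c,
      ← Finset.mul_sum] at *
    rw [hx, mul_zero]

theorem mem_signPerp {U : Finset V} {y : V → ℝ} :
    y ∈ signPerp U ↔ ∑ u, signVec U u * y u = 0 := Iff.rfl

/-- The linear map `(a + b) I + (a - b) S`, with `S` the Seidel matrix of `G`. Up to the factor
`1/4` and a change of signs, its quadratic form is the one that a representation with distances
`a, b` pulls back to the vectors with coordinate sum zero. -/
def distOp (G : SimpleGraph V) (a b : ℝ) : (V → ℝ) →ₗ[ℝ] (V → ℝ) :=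
  (a + b) • LinearMap.id + (a - b) • (seidel G).mulVecLin

theorem distOp_apply (G : SimpleGraph V) (a b : ℝ) (y : V → ℝ) (u : V) :
    distOp G a b y u = (a + b) * y u + (a - b) * ∑ v, seidel G u v * y v := by
  simp [distOp, Matrix.mulVec, dotProduct]

theorem dotProduct_distOp_comm (G : SimpleGraph V) (a b : ℝ) (y z : V → ℝ) :
    z ⬝ᵥ distOp G a b y = y ⬝ᵥ distOp G a b z := by
  have h : z ⬝ᵥ (seidel G *ᵥ y) = y ⬝ᵥ (seidel G *ᵥ z) := by
    have hs : (seidel G)ᵀ = seidel G := by ext u v; exact seidel_comm G v u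
    rw [dotProduct_mulVec, ← mulVec_transpose, hs, dotProduct_comm]
  simp only [distOp, LinearMap.add_apply, LinearMap.smul_apply, LinearMap.id_apply,
    mulVecLin_apply, dotProduct_add, dotProduct_smul, h, dotProduct_comm z y]

/-- The radical of the form of `distOp G a b` on the orthogonal complement of the `±1`-vector
of `U`. -/
def rad (G : SimpleGraph V) (U : Finset V) (a b : ℝ) : Submodule ℝ (V → ℝ) where
  carrier := {y | y ∈ signPerp U ∧ ∀ z ∈ signPerp U, z ⬝ᵥ distOp G a b y = 0}
  add_mem' {x y} hx hy := by
    refine ⟨add_mem hx.1 hy.1, fun z hz => ?_⟩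
    rw [map_add, dotProduct_add, hx.2 z hz, hy.2 z hz, add_zero]
  zero_mem' := ⟨zero_mem _, by simp⟩
  smul_mem' c x hx := by
    refine ⟨Submodule.smul_mem _ c hx.1, fun z hz => ?_⟩
    rw [map_smul, dotProduct_smul, hx.2 z hz, smul_zero]

theorem rad_le (G : SimpleGraph V) (U : Finset V) (a b : ℝ) : rad G U a b ≤ signPerp U :=
  fun _ h => h.1

/-- The Lagrange multiplier of a vector of the radical. -/
theorem exists_multiplier [Nonempty V] {G : SimpleGraph V} {U : Finset V} {a b : ℝ} {y : V → ℝ}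
    (hy : y ∈ rad G U a b) : ∃ l : ℝ, ∀ u, distOp G a b y u = l * signVec U u := by
  classical
  obtain ⟨o⟩ := ‹Nonempty V›
  refine ⟨signVec U o * distOp G a b y o, fun u => ?_⟩
  have h := hy.2 (signVec U u • Pi.single u 1 - signVec U o • Pi.single o 1) (by
    simp [mem_signPerp, mul_sub, Pi.single_apply, Finset.sum_sub_distrib, signVec_mul_self])
  simp only [sub_dotProduct, smul_dotProduct, single_one_dotProduct, smul_eq_mul] at h
  linear_combination (signVec U u) * h - distOp G a b y u * signVec_mul_self U u

theorem ker_inf_signPerp_le_rad (G : SimpleGraph V) (U : Finset V) (a b : ℝ) :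
    LinearMap.ker (distOp G a b) ⊓ signPerp U ≤ rad G U a b := by
  rintro y ⟨hy, hy'⟩
  refine ⟨hy', fun z _ => ?_⟩
  rw [LinearMap.mem_ker.mp hy, dotProduct_zero]

/-- Vectors in the radicals for two non-proportional pairs of distances are orthogonal. -/
theorem dotProduct_eq_zero_of_mem_rad {G : SimpleGraph V} {U : Finset V} {a b a' b' : ℝ}
    (h : a * b' ≠ a' * b) {y z : V → ℝ} (hy : y ∈ rad G U a b) (hz : z ∈ rad G U a' b') :
    y ⬝ᵥ z = 0 := by
  have h1 := hz.2 y hy.1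
  have h2 := hy.2 z hz.1
  rw [dotProduct_distOp_comm] at h2
  simp only [distOp, LinearMap.add_apply, LinearMap.smul_apply, LinearMap.id_apply,
    mulVecLin_apply, dotProduct_add, dotProduct_smul, smul_eq_mul] at h1 h2
  have h3 : (a * b' - a' * b) * (y ⬝ᵥ z) = 0 := by
    linear_combination (a - b) / 2 * h1 - (a' - b') / 2 * h2
  exact (mul_eq_zero.mp h3).resolve_left (sub_ne_zero.mpr h)

theorem disjoint_of_dotProduct {A B : Submodule ℝ (V → ℝ)}
    (h : ∀ x ∈ A, ∀ y ∈ B, x ⬝ᵥ y = 0) : Disjoint A B := by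
  rw [Submodule.disjoint_def]
  exact fun x hA hB => dotProduct_self_eq_zero.mp (h x hA x hB)

theorem finrank_add_le_of_disjoint {A B C : Submodule ℝ (V → ℝ)} (h : Disjoint A B)
    (hA : A ≤ C) (hB : B ≤ C) : finrank ℝ A + finrank ℝ B ≤ finrank ℝ C := by
  rw [← Submodule.finrank_sup_add_finrank_inf_eq, h.eq_bot, finrank_bot, add_zero]
  exact Submodule.finrank_mono (sup_le hA hB)

theorem finrank_le_add_of_ker {A R : Submodule ℝ (V → ℝ)} {E : Type*} [AddCommGroup E]
    [Module ℝ E] [FiniteDimensional ℝ E] (f : (V → ℝ) →ₗ[ℝ] E)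
    (h : ∀ y ∈ A, f y = 0 → y ∈ R) : finrank ℝ A ≤ finrank ℝ E + finrank ℝ R := by
  rw [← LinearMap.finrank_range_add_finrank_ker (f.domRestrict A)]
  refine add_le_add (Submodule.finrank_le _) ?_
  refine LinearMap.finrank_le_finrank_of_injective
    (f := (A.subtype.domRestrict (LinearMap.ker (f.domRestrict A))).codRestrict R
      (fun y => h _ y.1.2 y.2)) ?_
  intro x y hxy
  have := congrArg Subtype.val hxy
  exact Subtype.ext (Subtype.ext this)

/-- The functional with kernel `signPerp U`. -/
def signFunctional (U : Finset V) : (V → ℝ) →ₗ[ℝ] ℝ := Fintype.linearCombination ℝ (signVec U)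

theorem signFunctional_apply (U : Finset V) (y : V → ℝ) :
    signFunctional U y = ∑ u, signVec U u * y u := by
  simp [signFunctional, Fintype.linearCombination_apply, mul_comm]

theorem ker_signFunctional (U : Finset V) : LinearMap.ker (signFunctional U) = signPerp U := by
  ext y; rw [LinearMap.mem_ker, signFunctional_apply, mem_signPerp]

theorem finrank_le_finrank_inf_signPerp (U : Finset V) (A : Submodule ℝ (V → ℝ)) :
    finrank ℝ A ≤ finrank ℝ (A ⊓ signPerp U : Submodule ℝ (V → ℝ)) + 1 := by
  have h := finrank_le_add_of_ker (signFunctional U) (A := A) (R := A ⊓ signPerp U)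
    fun y hy h0 => ⟨hy, by rwa [← ker_signFunctional]⟩
  rw [finrank_self] at h
  omega

theorem finrank_signPerp [Nonempty V] (U : Finset V) :
    finrank ℝ (signPerp U) + 1 = Fintype.card V := by
  classical
  have h := LinearMap.finrank_range_add_finrank_ker (signFunctional U)
  obtain ⟨o⟩ := ‹Nonempty V›
  have h1 : LinearMap.range (signFunctional U) = ⊤ := by
    apply LinearMap.range_eq_top.mpr
    apply LinearMap.surjective
    intro h0
    have := congrArg (fun f => f (Pi.single o 1)) h0
    simp [signFunctional_apply, Pi.single_apply, signVec_ne_zero] at this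
  rw [h1, finrank_top, finrank_self, ker_signFunctional, finrank_fintype_fun_eq_card] at h
  omega

/-- If the `±1`-vector of `U` is not orthogonal to the kernel of `distOp G a b`, then the radical
is a proper subspace of that kernel. -/
theorem finrank_rad_lt {G : SimpleGraph V} {U : Finset V} {a b : ℝ}
    (h : ¬LinearMap.ker (distOp G a b) ≤ signPerp U) :
    finrank ℝ (rad G U a b) < finrank ℝ (LinearMap.ker (distOp G a b)) := by
  apply Submodule.finrank_lt_finrank_of_lt
  obtain ⟨v, hv, hvU⟩ := SetLike.not_le_iff_exists.mp h
  have hv0 := LinearMap.mem_ker.mp hv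
  refine lt_of_le_of_ne (fun y hy => ?_) (fun e => hvU (rad_le G U a b (e ▸ hv)))
  rw [LinearMap.mem_ker]
  have hall : ∀ z, z ⬝ᵥ distOp G a b y = 0 := by
    intro z
    have hs : signFunctional U v ≠ 0 := by
      rw [signFunctional_apply]; exact hvU
    have hz : z - (signFunctional U z / signFunctional U v) • v ∈ signPerp U := by
      rw [← ker_signFunctional, LinearMap.mem_ker, map_sub, map_smul, smul_eq_mul,
        div_mul_cancel₀ _ hs, sub_self]
    have h1 := hy.2 _ hz
    rw [sub_dotProduct, smul_dotProduct, dotProduct_distOp_comm G a b y v, hv0, dotProduct_zero,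
      smul_zero, sub_zero] at h1
    exact h1
  exact dotProduct_self_eq_zero.mp (hall _)

/-! ### Signature and dimension of a representation -/

section Representation

variable {G : SimpleGraph V} {U : Finset V} {a b : ℝ} {p q : ℕ} {φ : V → Space p q}

/-- The linear extension of a representation to signed combinations of the vertices. -/
def repMap (U : Finset V) (φ : V → Space p q) : (V → ℝ) →ₗ[ℝ] Space p q :=
  Fintype.linearCombination ℝ fun u => signVec U u • φ u

theorem repMap_apply (U : Finset V) (φ : V → Space p q) (y : V → ℝ) :
    repMap U φ y = ∑ u, (signVec U u * y u) • φ u := by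
  simp [repMap, Fintype.linearCombination_apply, smul_smul, mul_comm]

theorem form_repMap (hφ : IsRepresentation (switching G U) a b φ) {y z : V → ℝ}
    (hy : y ∈ signPerp U) (hz : z ∈ signPerp U) :
    form (repMap U φ y) (repMap U φ z) = 1 / 4 * (y ⬝ᵥ distOp G a b z) := by
  classical
  rw [repMap_apply, repMap_apply, form_sum_smul]
  have h1 : ∀ u v, form (φ u) (φ v) = 1 / 2 * form (φ u) (φ u) + 1 / 2 * form (φ v) (φ v) -
      1 / 2 * dissimilarity (switching G U) a b u v := by
    intro u v
    have := hφ u v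
    rw [scalarSquare_sub] at this
    linarith
  rw [mem_signPerp] at hy hz
  have h2 : ∀ u v, signVec U u * y u * (signVec U v * z v) * form (φ u) (φ v) =
      signVec U u * y u * (1 / 2 * form (φ u) (φ u) - (a + b) / 4) * (signVec U v * z v) +
      signVec U u * y u * (1 / 2 * form (φ v) (φ v) * (signVec U v * z v)) +
      (if u = v then (a + b) / 4 * (y u * z v) else 0) +
      y u * ((a - b) / 4 * (seidel G u v * z v)) := by
    intro u v
    rw [h1, dissimilarity_switching]
    have hu := signVec_mul_self U u
    have hv := signVec_mul_self U v
    split_ifs with huv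
    · subst huv
      linear_combination (y u * z u) * ((a + b) / 4 + (a - b) / 4 * seidel G u u *
        (signVec U u * signVec U u + 1)) * hu
    · linear_combination (y u * z v * (a - b) / 4 * seidel G u v) *
        (hu * (signVec U v * signVec U v) + hv)
  simp only [h2, Finset.sum_add_distrib, ← Finset.mul_sum, hz, mul_zero,
    ← Finset.sum_mul, hy, zero_mul, Finset.sum_ite_eq, Finset.mem_univ, if_true, zero_add]
  simp only [dotProduct, distOp_apply, mul_add, Finset.sum_add_distrib, Finset.mul_sum]
  congr 1
  · exact Finset.sum_congr rfl fun u _ => by ring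
  · exact Finset.sum_congr rfl fun u _ => Finset.sum_congr rfl fun v _ => by ring

theorem mem_rad_of_repMap_eq_zero (hφ : IsRepresentation (switching G U) a b φ) {y : V → ℝ}
    (hy : y ∈ signPerp U) (h : repMap U φ y = 0) : y ∈ rad G U a b := by
  refine ⟨hy, fun z hz => ?_⟩
  have h1 := form_repMap hφ hz hy
  rw [h] at h1
  have h2 : form (repMap U φ z) 0 = 0 := by simp [form]
  linarith

/-- The dimension of a representation is at least the rank of its form. -/
theorem Representable.finrank_signPerp_le (h : Representable (switching G U) a b p q) :
    finrank ℝ (signPerp U) ≤ p + q + finrank ℝ (rad G U a b) := by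
  obtain ⟨φ, hφ⟩ := h
  have := finrank_le_add_of_ker (repMap U φ) (A := signPerp U) (R := rad G U a b)
    (fun y hy h => mem_rad_of_repMap_eq_zero hφ hy h)
  simpa using this

/-- A subspace on which the form is nonnegative has, modulo the radical, dimension at most `p`. -/
theorem Representable.finrank_le_of_nonneg (h : Representable (switching G U) a b p q)
    {A : Submodule ℝ (V → ℝ)} (hA : A ≤ signPerp U) (hpos : ∀ y ∈ A, 0 ≤ y ⬝ᵥ distOp G a b y) :
    finrank ℝ A ≤ p + finrank ℝ (rad G U a b) := by
  obtain ⟨φ, hφ⟩ := h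
  have := finrank_le_add_of_ker ((LinearMap.funLeft ℝ ℝ Sum.inl).comp (repMap U φ) :
    (V → ℝ) →ₗ[ℝ] (Fin p → ℝ)) (A := A) (R := rad G U a b) ?_
  · simpa using this
  intro y hy h0
  refine mem_rad_of_repMap_eq_zero hφ (hA hy) ?_
  have hl : ∀ i, repMap U φ y (Sum.inl i) = 0 := fun i => congrFun h0 i
  have h1 := form_repMap hφ (hA hy) (hA hy)
  have h2 := hpos y hy
  have h3 : ∑ j, repMap U φ y (Sum.inr j) * repMap U φ y (Sum.inr j) = 0 := by
    refine le_antisymm ?_ (Finset.sum_nonneg fun j _ => mul_self_nonneg _)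
    simp only [form, hl, mul_zero, Finset.sum_const_zero] at h1
    linarith
  rw [Finset.sum_eq_zero_iff_of_nonneg fun j _ => mul_self_nonneg _] at h3
  ext (i | j)
  · exact hl i
  · exact mul_self_eq_zero.mp (h3 j (Finset.mem_univ j))

/-- A vector on which the form is negative forces a negative coordinate. -/
theorem Representable.pos_of_neg (h : Representable (switching G U) a b p q) {y : V → ℝ}
    (hy : y ∈ signPerp U) (hneg : y ⬝ᵥ distOp G a b y < 0) : 0 < q := by
  obtain ⟨φ, hφ⟩ := h
  by_contra hq
  obtain rfl : q = 0 := by omega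
  have h1 := form_repMap hφ hy hy
  have h2 : 0 ≤ form (repMap U φ y) (repMap U φ y) := by
    simp only [form, Finset.univ_eq_empty, Finset.sum_empty, sub_zero]
    exact Finset.sum_nonneg fun j _ => mul_self_nonneg _
  linarith

/-- Every switched dissimilarity matrix has a representation whose dimension is the rank of its
form. -/
theorem exists_representable [Nonempty V] (G : SimpleGraph V) (U : Finset V) (a b : ℝ) :
    ∃ p q, Representable (switching G U) a b p q ∧
      p + q + finrank ℝ (rad G U a b) ≤ finrank ℝ (signPerp U) := by
  classical
  obtain ⟨o⟩ := id ‹Nonempty V›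
  set D := dissimilarity (switching G U) a b with hD
  have hDs : ∀ u v, D u v = D v u := by
    intro u v
    rw [hD, dissimilarity_switching, dissimilarity_switching, seidel_comm G u v]
    simp only [eq_comm, mul_comm (signVec U u)]
  -- the Gram matrix of a representation that sends `o` to the origin
  let K : Matrix V V ℝ := Matrix.of fun u v => -(1 / 2) * (D u v - D u o - D v o)
  have hK : K.IsSymm := by
    ext u v
    simp only [K, Matrix.transpose_apply, Matrix.of_apply, hDs v u]
    ring
  obtain ⟨p, q, φ, hpq, hφ⟩ := exists_gram K hK
  refine ⟨p, q, ⟨φ, fun u v => ?_⟩, ?_⟩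
  · rw [scalarSquare_sub, hφ, hφ, hφ]
    have h0 : ∀ w, D w w = 0 := fun w => dissimilarity_self _ _ _ _
    simp only [K, Matrix.of_apply, h0]
    ring
  have hker : ∀ y ∈ rad G U a b, K *ᵥ (fun u => signVec U u * y u) = 0 := by
    intro y hy
    obtain ⟨l, hl⟩ := exists_multiplier hy
    have hsum := mem_signPerp.mp hy.1
    have hDy : ∀ u, ∑ v, D u v * (signVec U v * y v) = -(1 / 2) * l := by
      intro u
      have h1 : ∀ v, D u v * (signVec U v * y v) = (a + b) / 2 * (signVec U v * y v) -
          (if u = v then (a + b) / 2 * (signVec U v * y v) else 0) -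
          signVec U u * ((a - b) / 2 * (seidel G u v * y v)) := by
        intro v
        rw [hD, dissimilarity_switching]
        have hv := signVec_mul_self U v
        split_ifs <;> linear_combination (-(a - b) / 2 * signVec U u * seidel G u v * y v) * hv
      simp only [h1, Finset.sum_sub_distrib, ← Finset.mul_sum, hsum, mul_zero, Finset.sum_ite_eq,
        Finset.mem_univ, if_true]
      have h2 := hl u
      rw [distOp_apply] at h2
      linear_combination (-(1 / 2) * signVec U u) * h2 - 1 / 2 * l * signVec_mul_self U u
    ext u
    simp only [Matrix.mulVec, dotProduct, K, Matrix.of_apply, Pi.zero_apply]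
    have h1 : ∀ v, -(1 / 2) * (D u v - D u o - D v o) * (signVec U v * y v) =
        -(1 / 2) * (D u v * (signVec U v * y v)) + (1 / 2) * D u o * (signVec U v * y v) +
          (1 / 2) * (D o v * (signVec U v * y v)) := by
      intro v; rw [hDs v o]; ring
    simp only [h1, Finset.sum_add_distrib, ← Finset.mul_sum, hDy, hsum]
    ring
  have ho : K *ᵥ Pi.single o 1 = 0 := by
    ext u
    have h0 : D o o = 0 := dissimilarity_self _ _ _ _
    simp [K, h0]
  have hrn := LinearMap.finrank_range_add_finrank_ker K.mulVecLin
  have hrank : finrank ℝ (LinearMap.range K.mulVecLin) = K.rank := rfl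
  let f : (rad G U a b × ℝ) →ₗ[ℝ] (V → ℝ) :=
    ((LinearMap.pi fun u => signVec U u • LinearMap.proj u : (V → ℝ) →ₗ[ℝ] (V → ℝ)).comp
      (rad G U a b).subtype).coprod (LinearMap.toSpanSingleton ℝ (V → ℝ) (Pi.single o 1))
  have hf : ∀ x, f x = (fun u => signVec U u * x.1.1 u) + x.2 • Pi.single o 1 := by
    intro x; ext u; simp [f]
  have hfk : ∀ x, f x ∈ LinearMap.ker K.mulVecLin := by
    intro x
    rw [LinearMap.mem_ker, hf, map_add, map_smul, mulVecLin_apply, mulVecLin_apply, ho,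
      hker _ x.1.2, smul_zero, add_zero]
  have hle := LinearMap.finrank_le_finrank_of_injective
    (f := f.codRestrict (LinearMap.ker K.mulVecLin) hfk) (by
      rw [← LinearMap.ker_eq_bot, LinearMap.ker_eq_bot']
      intro x hx
      have hx' : f x = 0 := congrArg Subtype.val hx
      rw [hf] at hx'
      have h2 : x.2 = 0 := by
        have h3 := congrArg (fun g : V → ℝ => ∑ u, g u) hx'
        simpa [Finset.sum_add_distrib, mem_signPerp.mp x.1.2.1, Pi.single_apply] using h3
      refine Prod.ext (Subtype.ext (funext fun u => ?_)) h2
      have h4 := congrFun hx' u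
      simpa [h2, signVec_ne_zero] using h4)
  rw [finrank_prod, finrank_self] at hle
  rw [finrank_fintype_fun_eq_card, hrank, ← hpq] at hrn
  have := finrank_signPerp U
  omega

end Representation

end

section

variable {X : Type*}

/-! ### The Hamming graph: row and column sums -/

open Classical in
theorem seidel_hamming (u v : X × X) : seidel (hamming X) u v =
    1 + 3 * (if u.1 = v.1 then if u.2 = v.2 then 1 else 0 else 0) -
      2 * (if u.1 = v.1 then 1 else 0) - 2 * (if u.2 = v.2 then 1 else 0) := by
  obtain ⟨i, j⟩ := u
  obtain ⟨k, l⟩ := v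
  by_cases h1 : i = k <;> by_cases h2 : j = l <;> simp [seidel, hamming, h1, h2] <;> norm_num

theorem hamming_adj_swap (u v : X × X) :
    (hamming X).Adj (Equiv.prodComm X X u) (Equiv.prodComm X X v) ↔ (hamming X).Adj u v := by
  simp only [hamming, Equiv.prodComm_apply, Prod.fst_swap, Prod.snd_swap]
  tauto

theorem map_prodComm (S T : Finset X) :
    (S ×ˢ T).map (Equiv.prodComm X X).toEmbedding = T ×ˢ S := by
  ext ⟨i, j⟩; simp [and_comm]

variable [Fintype X]

/-- The row and column sums of a function on `X × X`. -/
def lineSums (X : Type*) [Fintype X] : (X × X → ℝ) →ₗ[ℝ] (X → ℝ) × (X → ℝ) where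
  toFun y := (fun i => ∑ j, y (i, j), fun j => ∑ i, y (i, j))
  map_add' y z := by ext <;> simp [Finset.sum_add_distrib]
  map_smul' c y := by ext <;> simp [Finset.mul_sum]

/-- The sum of all values. -/
def total (X : Type*) [Fintype X] : (X × X → ℝ) →ₗ[ℝ] ℝ where
  toFun y := ∑ i, ∑ j, y (i, j)
  map_add' y z := by simp [Finset.sum_add_distrib]
  map_smul' c y := by simp [Finset.mul_sum]

theorem lineSums_fst (y : X × X → ℝ) (i : X) : (lineSums X y).1 i = ∑ j, y (i, j) := rfl

theorem lineSums_snd (y : X × X → ℝ) (j : X) : (lineSums X y).2 j = ∑ i, y (i, j) := rfl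

theorem total_apply (y : X × X → ℝ) : total X y = ∑ i, ∑ j, y (i, j) := rfl

theorem sum_lineSums_fst (y : X × X → ℝ) : ∑ i, (lineSums X y).1 i = total X y := rfl

theorem sum_lineSums_snd (y : X × X → ℝ) : ∑ j, (lineSums X y).2 j = total X y :=
  Finset.sum_comm

theorem total_eq_zero_of_lineSums {y : X × X → ℝ} (h : lineSums X y = 0) : total X y = 0 := by
  rw [← sum_lineSums_fst, h]; simp

theorem distOp_hamming (a b : ℝ) (y : X × X → ℝ) (i j : X) :
    distOp (hamming X) a b y (i, j) = (4 * a - 2 * b) * y (i, j) +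
      (a - b) * (total X y - 2 * (lineSums X y).1 i - 2 * (lineSums X y).2 j) := by
  classical
  have h : ∑ v, seidel (hamming X) (i, j) v * y v =
      total X y + 3 * y (i, j) - 2 * (lineSums X y).1 i - 2 * (lineSums X y).2 j := by
    simp only [seidel_hamming, sub_mul, add_mul, one_mul, mul_assoc, Finset.sum_sub_distrib,
      Finset.sum_add_distrib, ← Finset.mul_sum, ite_mul, zero_mul, Fintype.sum_prod_type]
    congr 1
    · congr 1
      · simp [total_apply]
      · rw [Finset.sum_comm]; simp [lineSums_fst]
    · simp [lineSums_snd]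
  rw [distOp_apply, h]
  ring

theorem distOp_one_two (y : X × X → ℝ) (i j : X) :
    distOp (hamming X) 1 2 y (i, j) =
      2 * (lineSums X y).1 i + 2 * (lineSums X y).2 j - total X y := by
  rw [distOp_hamming]; ring

theorem dotProduct_distOp_one_two (y : X × X → ℝ) :
    y ⬝ᵥ distOp (hamming X) 1 2 y = 2 * ∑ i, (lineSums X y).1 i ^ 2 +
      2 * ∑ j, (lineSums X y).2 j ^ 2 - total X y ^ 2 := by
  simp only [dotProduct, Fintype.sum_prod_type, distOp_one_two, mul_sub, mul_add,
    Finset.sum_sub_distrib, Finset.sum_add_distrib]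
  congr 1
  · congr 1
    · rw [Finset.mul_sum]
      refine Finset.sum_congr rfl fun i _ => ?_
      rw [← Finset.sum_mul, ← lineSums_fst]; ring
    · rw [Finset.sum_comm, Finset.mul_sum]
      refine Finset.sum_congr rfl fun j _ => ?_
      rw [← Finset.sum_mul, ← lineSums_snd]; ring
  · simp only [← Finset.sum_mul, ← total_apply]; ring

theorem ker_lineSums_le (X : Type*) [Fintype X] :
    LinearMap.ker (lineSums X) ≤ LinearMap.ker (distOp (hamming X) 1 2) := by
  intro y hy
  have hy := LinearMap.mem_ker.mp hy
  rw [LinearMap.mem_ker]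
  ext ⟨i, j⟩
  rw [distOp_one_two, hy, total_eq_zero_of_lineSums hy]
  simp

theorem finrank_ker_lineSums [Nonempty X] :
    finrank ℝ (LinearMap.ker (lineSums X)) + 2 * Fintype.card X =
      Fintype.card X * Fintype.card X + 1 := by
  classical
  -- the range of `lineSums` is cut out by the equality of the two totals
  let f : ((X → ℝ) × (X → ℝ)) →ₗ[ℝ] ℝ :=
    (Fintype.linearCombination ℝ fun _ => (1 : ℝ)).coprod
      (-(Fintype.linearCombination ℝ fun _ => (1 : ℝ)))
  have hf : ∀ x, f x = ∑ i, x.1 i - ∑ j, x.2 j := by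
    intro x; simp [f, Fintype.linearCombination_apply, sub_eq_add_neg]
  have hm : (Fintype.card X : ℝ) ≠ 0 := Nat.cast_ne_zero.mpr Fintype.card_ne_zero
  have hrange : LinearMap.range (lineSums X) = LinearMap.ker f := by
    ext x
    rw [LinearMap.mem_range, LinearMap.mem_ker, hf]
    constructor
    · rintro ⟨y, rfl⟩
      rw [sum_lineSums_fst, sum_lineSums_snd, sub_self]
    · intro h
      set m : ℝ := ((Fintype.card X : ℕ) : ℝ) with hmdef
      have h' : ∑ j, x.2 j = ∑ i, x.1 i := by linarith
      refine ⟨fun u => x.1 u.1 / m + x.2 u.2 / m - (∑ i, x.1 i) / (m * m), ?_⟩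
      ext i
      · simp only [lineSums_fst, Finset.sum_sub_distrib, Finset.sum_add_distrib,
          ← Finset.sum_div, h', Finset.sum_const, Finset.card_univ, nsmul_eq_mul, ← hmdef]
        field_simp; ring
      · simp only [lineSums_snd, Finset.sum_sub_distrib, Finset.sum_add_distrib,
          ← Finset.sum_div, Finset.sum_const, Finset.card_univ, nsmul_eq_mul, ← hmdef]
        field_simp; ring
  have h1 := LinearMap.finrank_range_add_finrank_ker (lineSums X)
  have h2 := LinearMap.finrank_range_add_finrank_ker f
  have h3 : LinearMap.range f = ⊤ := by
    apply LinearMap.range_eq_top.mpr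
    apply LinearMap.surjective
    intro h0
    obtain ⟨o⟩ := ‹Nonempty X›
    have := congrArg (fun g => g (Pi.single o 1, 0)) h0
    simp [hf] at this
  rw [h3, finrank_top, finrank_self, ← hrange] at h2
  simp only [finrank_fintype_fun_eq_card, finrank_prod, Fintype.card_prod] at h1 h2
  omega

theorem ker_distOp_inf_ker_total [Nonempty X] :
    LinearMap.ker (distOp (hamming X) 1 2) ⊓ LinearMap.ker (total X) ≤
      LinearMap.ker (lineSums X) := by
  rintro y ⟨hy, ht⟩
  have ht := LinearMap.mem_ker.mp ht
  have hm : (Fintype.card X : ℝ) ≠ 0 := Nat.cast_ne_zero.mpr Fintype.card_ne_zero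
  have h : ∀ i j, (lineSums X y).1 i + (lineSums X y).2 j = 0 := by
    intro i j
    have := congrFun (LinearMap.mem_ker.mp hy) (i, j)
    rw [distOp_one_two, ht] at this
    simp only [Pi.zero_apply] at this
    linarith
  rw [LinearMap.mem_ker]
  ext i
  · have h1 : ∑ j, ((lineSums X y).1 i + (lineSums X y).2 j) = 0 :=
      Finset.sum_eq_zero fun j _ => h i j
    rw [Finset.sum_add_distrib, sum_lineSums_snd, ht] at h1
    simpa [hm] using h1
  · have h1 : ∑ k, ((lineSums X y).1 k + (lineSums X y).2 i) = 0 :=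
      Finset.sum_eq_zero fun k _ => h k i
    rw [Finset.sum_add_distrib, sum_lineSums_fst, ht] at h1
    simpa [hm] using h1

theorem total_eq_zero_of_mem_ker {y : X × X → ℝ} [Nonempty X] (hX : Fintype.card X ≠ 4)
    (hy : y ∈ LinearMap.ker (distOp (hamming X) 1 2)) : total X y = 0 := by
  have h1 : ∑ i, ∑ j, distOp (hamming X) 1 2 y (i, j) = 0 := by
    rw [LinearMap.mem_ker.mp hy]; simp
  simp only [distOp_one_two, Finset.sum_sub_distrib, Finset.sum_add_distrib, ← Finset.mul_sum,
    sum_lineSums_snd, sum_lineSums_fst, Finset.sum_const, Finset.card_univ, nsmul_eq_mul] at h1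
  have hm : (Fintype.card X : ℝ) ≠ 0 := Nat.cast_ne_zero.mpr Fintype.card_ne_zero
  have h4 : (Fintype.card X : ℝ) - 4 ≠ 0 := sub_ne_zero.mpr (by exact_mod_cast hX)
  have h2 : (Fintype.card X : ℝ) * ((Fintype.card X : ℝ) - 4) * total X y = 0 := by
    linear_combination -h1
  exact (mul_eq_zero.mp h2).resolve_left (mul_ne_zero hm h4)

theorem ker_distOp_eq [Nonempty X] (hX : Fintype.card X ≠ 4) :
    LinearMap.ker (distOp (hamming X) 1 2) = LinearMap.ker (lineSums X) :=
  le_antisymm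
    (fun _ hy => ker_distOp_inf_ker_total
      ⟨hy, LinearMap.mem_ker.mpr (total_eq_zero_of_mem_ker hX hy)⟩)
    (ker_lineSums_le X)

theorem one_mem_ker_distOp (hX : Fintype.card X = 4) :
    (1 : X × X → ℝ) ∈ LinearMap.ker (distOp (hamming X) 1 2) := by
  rw [LinearMap.mem_ker]
  ext ⟨i, j⟩
  rw [distOp_one_two, lineSums_fst, lineSums_snd, total_apply]
  simp [hX]; norm_num

/-- For `m = 4` the constant functions join the kernel. -/
theorem finrank_ker_distOp_of_card_eq_four (hX : Fintype.card X = 4) :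
    finrank ℝ (LinearMap.ker (distOp (hamming X) 1 2)) = 10 := by
  have : Nonempty X := Fintype.card_pos_iff.mp (by omega)
  have h1 := finrank_ker_lineSums (X := X)
  have h2 := finrank_le_add_of_ker (total X) (A := LinearMap.ker (distOp (hamming X) 1 2))
    (R := LinearMap.ker (lineSums X)) fun y hy h0 => ker_distOp_inf_ker_total ⟨hy, h0⟩
  have h3 := Submodule.finrank_lt_finrank_of_lt (lt_of_le_of_ne (ker_lineSums_le X) (fun e => by
    have h := one_mem_ker_distOp hX
    rw [← e] at h
    have h := total_eq_zero_of_lineSums (LinearMap.mem_ker.mp h)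
    rw [total_apply] at h
    simp [hX] at h))
  rw [finrank_self] at h2
  rw [hX] at h1
  omega

/-! ### Unions of parallel lines -/

/-- `U` is the union of `s` parallel lines, that is, of `s` rows or of `s` columns
of `X × X`. -/
def IsUnionOfLines (s : ℕ) (U : Finset (X × X)) : Prop :=
  ∃ T : Finset X, T.card = s ∧ (U = T ×ˢ Finset.univ ∨ U = Finset.univ ×ˢ T)

theorem IsUnionOfLines.card_eq {s : ℕ} {U : Finset (X × X)} (h : IsUnionOfLines s U) :
    U.card = s * Fintype.card X := by
  obtain ⟨T, rfl, rfl | rfl⟩ := h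
  · rw [Finset.card_product, Finset.card_univ]
  · rw [Finset.card_product, Finset.card_univ, mul_comm]

/-- Rows and columns are interchangeable. -/
theorem IsUnionOfLines.exists_rows {s : ℕ} {U : Finset (X × X)} (h : IsUnionOfLines s U) :
    ∃ T : Finset X, T.card = s ∧ ∀ a b p q, Representable (switching (hamming X) U) a b p q →
      Representable (switching (hamming X) (T ×ˢ Finset.univ)) a b p q := by
  obtain ⟨T, hT, rfl | rfl⟩ := h
  · exact ⟨T, hT, fun _ _ _ _ h => h⟩
  · refine ⟨T, hT, fun a b p q h => ?_⟩
    apply Representable.map_automorphism (Equiv.prodComm X X) hamming_adj_swap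
    rwa [map_prodComm]

/-- If the `±1`-vector of `U` is orthogonal to all functions with zero row and column sums, then
`U` is a union of parallel lines. -/
theorem exists_isUnionOfLines {U : Finset (X × X)}
    (h : LinearMap.ker (lineSums X) ≤ signPerp U) : ∃ s, IsUnionOfLines s U := by
  classical
  have key : ∀ i i' j j' : X, signVec U (i, j) - signVec U (i', j) - signVec U (i, j') +
      signVec U (i', j') = 0 := by
    intro i i' j j'
    have hz : (Pi.single (i, j) 1 - Pi.single (i', j) 1 - Pi.single (i, j') 1 +
        Pi.single (i', j') 1 : X × X → ℝ) ∈ LinearMap.ker (lineSums X) := by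
      rw [LinearMap.mem_ker]
      ext k <;> simp [lineSums, Pi.single_apply, Prod.ext_iff, ite_and,
        Finset.sum_add_distrib, Finset.sum_sub_distrib, Finset.sum_ite_irrel]
    have := mem_signPerp.mp (h hz)
    simpa [mul_add, mul_sub, Finset.sum_add_distrib, Finset.sum_sub_distrib, Pi.single_apply]
      using this
  have hmem : ∀ u, signVec U u = -1 ↔ u ∈ U := by
    intro u; unfold signVec; split_ifs with hu <;> simp [hu]; norm_num
  have hnot : ∀ u, signVec U u = 1 ↔ u ∉ U := by
    intro u; unfold signVec; split_ifs with hu <;> simp [hu]; norm_num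
  have hb : ∀ u, -1 ≤ signVec U u ∧ signVec U u ≤ 1 := by
    intro u; unfold signVec; split_ifs <;> norm_num
  by_cases hrow : ∀ i j j', (i, j) ∈ U → (i, j') ∈ U
  · refine ⟨_, Finset.univ.filter fun i => ∃ j, (i, j) ∈ U, rfl, Or.inl ?_⟩
    ext ⟨i, j⟩
    simp only [Finset.mem_product, Finset.mem_filter, Finset.mem_univ, true_and, and_true]
    exact ⟨fun h => ⟨j, h⟩, fun ⟨j', h⟩ => hrow i j' j h⟩
  by_cases hcol : ∀ j i i', (i, j) ∈ U → (i', j) ∈ U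
  · refine ⟨_, Finset.univ.filter fun j => ∃ i, (i, j) ∈ U, rfl, Or.inr ?_⟩
    ext ⟨i, j⟩
    simp only [Finset.mem_product, Finset.mem_filter, Finset.mem_univ, true_and]
    exact ⟨fun h => ⟨i, h⟩, fun ⟨i', h⟩ => hcol j i' i h⟩
  push Not at hrow hcol
  obtain ⟨i, j, j', h1, h2⟩ := hrow
  obtain ⟨l, k, k', h3, h4⟩ := hcol
  -- column `j` lies in `U`, while row `k'` is disjoint from `U`
  rw [← hmem] at h1 h3
  rw [← hnot] at h2 h4
  have e1 := key i k' j j'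
  have e2 := key k k' j l
  have b1 := hb (k', j)
  have b2 := hb (k', j')
  have b3 := hb (k, j)
  linarith

section Rows

variable (T : Finset X)

theorem signVec_rows (i j : X) :
    signVec (T ×ˢ Finset.univ : Finset (X × X)) (i, j) = signVec T i := by
  classical
  simp [signVec]

theorem sum_signVec : ∑ i, signVec T i = (Fintype.card X : ℝ) - 2 * T.card := by
  classical
  have h : ∀ i, signVec T i = 1 - 2 * if i ∈ T then 1 else 0 := by
    intro i; unfold signVec; split_ifs <;> norm_num
  simp only [h, Finset.sum_sub_distrib, ← Finset.mul_sum]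
  simp

theorem mem_signPerp_rows {y : X × X → ℝ} :
    y ∈ signPerp (T ×ˢ Finset.univ : Finset (X × X)) ↔
      ∑ i, signVec T i * (lineSums X y).1 i = 0 := by
  rw [mem_signPerp, Fintype.sum_prod_type]
  simp only [signVec_rows, ← Finset.mul_sum, ← lineSums_fst]

/-- The Lagrange multiplier of a vector of the radical vanishes, unless `s = |T|` satisfies
`(m - 2) (m - 2 s)² = m² (m - 4)`. -/
theorem rad_rows_le [Nonempty X]
    (hT : ((Fintype.card X : ℝ) - 2) * ((Fintype.card X : ℝ) - 2 * T.card) ^ 2 =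
      (Fintype.card X : ℝ) ^ 2 * ((Fintype.card X : ℝ) - 4) →
        (Fintype.card X : ℝ) - 2 * T.card = 0) :
    rad (hamming X) (T ×ˢ Finset.univ) 1 2 ≤ LinearMap.ker (distOp (hamming X) 1 2) := by
  intro y hy
  obtain ⟨l, hl⟩ := exists_multiplier hy
  have h0 := (mem_signPerp_rows T).mp hy.1
  have hk := sum_signVec T
  have hm : (Fintype.card X : ℝ) ≠ 0 := Nat.cast_ne_zero.mpr Fintype.card_ne_zero
  set m : ℝ := ((Fintype.card X : ℕ) : ℝ)
  set k : ℝ := m - 2 * T.card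
  set t := total X y with ht
  have h1 : ∀ i, 2 * m * (lineSums X y).1 i + (2 - m) * t = l * m * signVec T i := by
    intro i
    have h2 : ∑ j, distOp (hamming X) 1 2 y (i, j) = ∑ j : X, l * signVec T i :=
      Finset.sum_congr rfl fun j _ => by rw [hl, signVec_rows]
    simp only [distOp_one_two, Finset.sum_sub_distrib, Finset.sum_add_distrib, ← Finset.mul_sum,
      sum_lineSums_snd, Finset.sum_const, Finset.card_univ, nsmul_eq_mul] at h2
    linear_combination h2
  have h2 : (4 - m) * t = l * k := by
    have h3 : ∑ i, (2 * m * (lineSums X y).1 i + (2 - m) * t) = ∑ i, l * m * signVec T i :=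
      Finset.sum_congr rfl fun i _ => h1 i
    simp only [Finset.sum_add_distrib, ← Finset.mul_sum, sum_lineSums_fst, Finset.sum_const,
      Finset.card_univ, nsmul_eq_mul, hk] at h3
    apply mul_left_cancel₀ hm
    linear_combination h3
  have h3 : (2 - m) * t * k = l * m ^ 2 := by
    have h4 : ∑ i, signVec T i * (2 * m * (lineSums X y).1 i + (2 - m) * t) =
        ∑ i : X, l * m :=
      Finset.sum_congr rfl fun i _ => by
        rw [h1]; linear_combination l * m * signVec_mul_self T i
    simp only [mul_add, Finset.sum_add_distrib, mul_left_comm _ (2 * m), ← Finset.mul_sum, h0,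
      ← Finset.sum_mul, hk, Finset.sum_const, Finset.card_univ, nsmul_eq_mul] at h4
    linear_combination h4
  have hl0 : l = 0 := by
    have hm2 : m ^ 2 ≠ 0 := pow_ne_zero 2 hm
    have h5 : t * ((m - 2) * k ^ 2 - m ^ 2 * (m - 4)) = 0 := by
      linear_combination (-k) * h3 + m ^ 2 * h2
    rcases mul_eq_zero.mp h5 with h6 | h6
    · rw [h6] at h3
      exact (mul_eq_zero.mp (by linear_combination -h3 : l * m ^ 2 = 0)).resolve_right hm2
    · rw [hT (sub_eq_zero.mp h6)] at h3
      exact (mul_eq_zero.mp (by linear_combination -h3 : l * m ^ 2 = 0)).resolve_right hm2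
  rw [LinearMap.mem_ker]
  ext u
  rw [hl, hl0, zero_mul, Pi.zero_apply]

/-- The form is nonnegative when `m² (m - 4) ≤ (m - 2) (m - 2 s)²`. -/
theorem nonneg_rows [Nonempty X] (h2 : 2 ≤ Fintype.card X)
    (hT : (Fintype.card X : ℝ) ^ 2 * ((Fintype.card X : ℝ) - 4) ≤
      ((Fintype.card X : ℝ) - 2) * ((Fintype.card X : ℝ) - 2 * T.card) ^ 2)
    {y : X × X → ℝ} (hy : y ∈ signPerp (T ×ˢ Finset.univ : Finset (X × X))) :
    0 ≤ y ⬝ᵥ distOp (hamming X) 1 2 y := by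
  rw [dotProduct_distOp_one_two]
  have h0 := (mem_signPerp_rows T).mp hy
  have hk := sum_signVec T
  have hm : (0 : ℝ) < Fintype.card X := by exact_mod_cast Fintype.card_pos
  have hm2 : (2 : ℝ) ≤ Fintype.card X := by exact_mod_cast h2
  have hc := sq_sum_le_card_mul_sum_sq (s := Finset.univ) (f := (lineSums X y).2)
  rw [sum_lineSums_snd, Finset.card_univ] at hc
  have hr := Finset.sum_mul_sq_le_sq_mul_sq Finset.univ
    (fun i => (Fintype.card X : ℝ) - (Fintype.card X - 2 * T.card) * signVec T i)
    (lineSums X y).1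
  set m : ℝ := ((Fintype.card X : ℕ) : ℝ) with hmdef
  set k : ℝ := m - 2 * T.card
  set t := total X y with ht
  set R := ∑ i, (lineSums X y).1 i ^ 2
  set C := ∑ j, (lineSums X y).2 j ^ 2
  have e1 : ∑ i, (m - k * signVec T i) * (lineSums X y).1 i = m * t := by
    simp only [sub_mul, Finset.sum_sub_distrib, mul_assoc, ← Finset.mul_sum, h0, sum_lineSums_fst,
      mul_zero, sub_zero, ht]
  have e2 : ∑ i, (m - k * signVec T i) ^ 2 = m * (m ^ 2 - k ^ 2) := by
    have : ∀ i, (m - k * signVec T i) ^ 2 = m ^ 2 + k ^ 2 - 2 * m * k * signVec T i := by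
      intro i; linear_combination k ^ 2 * signVec_mul_self T i
    simp only [this, Finset.sum_sub_distrib, ← Finset.mul_sum, hk, Finset.sum_const,
      Finset.card_univ, nsmul_eq_mul, ← hmdef]
    ring
  rw [e1, e2] at hr
  have hR : 0 ≤ R := Finset.sum_nonneg fun i _ => sq_nonneg _
  have hr' : m * t ^ 2 ≤ (m ^ 2 - k ^ 2) * R := by
    refine le_of_mul_le_mul_left ?_ hm
    linear_combination hr
  have h5 : 0 ≤ R * ((m - 2) * k ^ 2 - m ^ 2 * (m - 4)) := mul_nonneg hR (by linarith)
  have h6 : 0 ≤ (m - 2) * ((m ^ 2 - k ^ 2) * R - m * t ^ 2) :=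
    mul_nonneg (by linarith) (by linarith)
  have h7 : 0 ≤ m * (m * C - t ^ 2) := mul_nonneg hm.le (by linarith)
  refine nonneg_of_mul_nonneg_right (b := 2 * R + 2 * C - t ^ 2) (a := m ^ 2) ?_ (by positivity)
  linear_combination h5 + h6 + 2 * h7

/-- The form takes a negative value when `(m - 2) (m - 2 s)² < m² (m - 4)`. -/
theorem exists_neg_rows [Nonempty X] (h5 : 5 ≤ Fintype.card X)
    (hT : ((Fintype.card X : ℝ) - 2) * ((Fintype.card X : ℝ) - 2 * T.card) ^ 2 <
      (Fintype.card X : ℝ) ^ 2 * ((Fintype.card X : ℝ) - 4)) :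
    ∃ y ∈ signPerp (T ×ˢ Finset.univ : Finset (X × X)),
      y ⬝ᵥ distOp (hamming X) 1 2 y < 0 := by
  have hk := sum_signVec T
  have hm : (0 : ℝ) < Fintype.card X := by exact_mod_cast Fintype.card_pos
  set m : ℝ := ((Fintype.card X : ℕ) : ℝ) with hmdef
  set k : ℝ := m - 2 * T.card
  -- constant along each row, with row values the projection of the constants to the admissible
  -- row vectors
  let y : X × X → ℝ := fun u => m - k * signVec T u.1
  have er : ∀ i, (lineSums X y).1 i = m * (m - k * signVec T i) := by
    intro i; simp [lineSums_fst, y, hmdef, mul_sub]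
  have e1 : ∑ i, (m - k * signVec T i) = m ^ 2 - k ^ 2 := by
    simp only [Finset.sum_sub_distrib, ← Finset.mul_sum, hk, Finset.sum_const, Finset.card_univ,
      nsmul_eq_mul, ← hmdef]; ring
  have e2 : ∑ i, (m - k * signVec T i) ^ 2 = m * (m ^ 2 - k ^ 2) := by
    have : ∀ i, (m - k * signVec T i) ^ 2 = m ^ 2 + k ^ 2 - 2 * m * k * signVec T i := by
      intro i; linear_combination k ^ 2 * signVec_mul_self T i
    simp only [this, Finset.sum_sub_distrib, ← Finset.mul_sum, hk, Finset.sum_const,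
      Finset.card_univ, nsmul_eq_mul, ← hmdef]
    ring
  have ec : ∀ j, (lineSums X y).2 j = m ^ 2 - k ^ 2 := by
    intro j; rw [lineSums_snd, ← e1]
  have et : total X y = m * (m ^ 2 - k ^ 2) := by
    rw [← sum_lineSums_fst, ← e1, Finset.mul_sum]
    exact Finset.sum_congr rfl fun i _ => er i
  refine ⟨y, ?_, ?_⟩
  · rw [mem_signPerp_rows]
    have : ∀ i, signVec T i * (lineSums X y).1 i = m * m * signVec T i - m * k := by
      intro i; rw [er]; linear_combination (-m * k) * signVec_mul_self T i
    simp only [this, Finset.sum_sub_distrib, ← Finset.mul_sum, hk, Finset.sum_const,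
      Finset.card_univ, nsmul_eq_mul, ← hmdef]
    ring
  · rw [dotProduct_distOp_one_two, et]
    simp only [er, ec, mul_pow, ← Finset.mul_sum, e2, Finset.sum_const, Finset.card_univ,
      nsmul_eq_mul, ← hmdef]
    have hd : 0 < m ^ 2 - k ^ 2 := by
      have h4 : (5 : ℝ) ≤ m := by rw [hmdef]; exact_mod_cast h5
      have : (m - 2) * k ^ 2 < (m - 2) * m ^ 2 := by nlinarith [pow_pos hm 2]
      linarith [lt_of_mul_lt_mul_left this (by linarith)]
    have := mul_neg_of_pos_of_neg (mul_pos hm hd) (sub_neg.mpr hT)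
    linear_combination this

theorem ker_lineSums_le_signPerp {s : ℕ} {U : Finset (X × X)} (h : IsUnionOfLines s U) :
    LinearMap.ker (lineSums X) ≤ signPerp U := by
  intro y hy
  have hy := LinearMap.mem_ker.mp hy
  obtain ⟨T, -, rfl | rfl⟩ := h
  · rw [mem_signPerp_rows, hy]; simp
  · rw [mem_signPerp, Fintype.sum_prod_type, Finset.sum_comm]
    have : ∀ i j, signVec (Finset.univ ×ˢ T : Finset (X × X)) (i, j) = signVec T j := by
      intro i j; classical simp [signVec]
    simp only [this, ← Finset.mul_sum, ← lineSums_snd, hy]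
    simp

end Rows

end

section

variable {X : Type*} [Fintype X]

/-! ### Delsarte cliques of the Hamming graph -/

theorem mem_spectrum_iff_exists_mulVec {V : Type*} [Fintype V] [DecidableEq V] (M : Matrix V V ℝ)
    (θ : ℝ) : θ ∈ spectrum ℝ M ↔ ∃ v ≠ 0, M *ᵥ v = θ • v := by
  rw [← Matrix.spectrum_toLin', ← Module.End.hasEigenvalue_iff_mem_spectrum]
  constructor
  · intro h
    obtain ⟨v, hv⟩ := h.exists_hasEigenvector
    exact ⟨v, hv.2, by simpa using hv.apply_eq_smul⟩
  · rintro ⟨v, hv, h⟩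
    exact Module.End.hasEigenvalue_of_hasEigenvector
      ⟨Module.End.mem_eigenspace_iff.mpr (by simpa using h), hv⟩

theorem adjMatrix_hamming_mulVec [DecidableRel (hamming X).Adj] (y : X × X → ℝ) (i j : X) :
    ((hamming X).adjMatrix ℝ *ᵥ y) (i, j) =
      (lineSums X y).1 i + (lineSums X y).2 j - 2 * y (i, j) := by
  classical
  have hadj : ∀ u v : X × X, (hamming X).Adj u v ↔
      (u.1 = v.1 ∧ u.2 ≠ v.2) ∨ (u.1 ≠ v.1 ∧ u.2 = v.2) := fun _ _ => Iff.rfl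
  have h : ∀ k l, (hamming X).adjMatrix ℝ (i, j) (k, l) =
      (if i = k then 1 else 0) + (if j = l then 1 else 0) -
        2 * (if i = k then if j = l then 1 else 0 else 0) := by
    intro k l
    by_cases h1 : i = k <;> by_cases h2 : j = l <;>
      simp [SimpleGraph.adjMatrix_apply, hadj, h1, h2]
    norm_num
  simp only [Matrix.mulVec, dotProduct, Fintype.sum_prod_type, h, sub_mul, add_mul, mul_assoc,
    Finset.sum_sub_distrib, Finset.sum_add_distrib, ← Finset.mul_sum, ite_mul, zero_mul, one_mul]
  congr 1
  · congr 1
    · rw [Finset.sum_comm]; simp [lineSums_fst]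
    · simp [lineSums_snd]
  · simp

theorem hamming_degree [DecidableRel (hamming X).Adj] (u : X × X)
    [Fintype ((hamming X).neighborSet u)] :
    (((hamming X).degree u : ℕ) : ℝ) = 2 * Fintype.card X - 2 := by
  have h := SimpleGraph.adjMatrix_mulVec_const_apply (G := hamming X) (a := (1 : ℝ)) (v := u)
  obtain ⟨i, j⟩ := u
  rw [adjMatrix_hamming_mulVec] at h
  simp only [lineSums_fst, lineSums_snd, Function.const_apply, Finset.sum_const, Finset.card_univ,
    nsmul_eq_mul, mul_one] at h
  convert h.symm using 1
  · congr!
  · ring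

theorem isLeast_spectrum_hamming [DecidableEq (X × X)] [DecidableRel (hamming X).Adj]
    (hX : 2 ≤ Fintype.card X) : IsLeast (spectrum ℝ ((hamming X).adjMatrix ℝ)) (-2) := by
  classical
  constructor
  · rw [mem_spectrum_iff_exists_mulVec]
    obtain ⟨a, b, hab⟩ := Fintype.exists_pair_of_one_lt_card (α := X) (by omega)
    let f : X → ℝ := Pi.single a 1 - Pi.single b 1
    have hf : ∑ i, f i = 0 := by simp [f]
    refine ⟨fun u => f u.1 * f u.2, fun h0 => ?_, ?_⟩
    · have := congrFun h0 (a, a)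
      simp [f, hab] at this
    · ext ⟨i, j⟩
      rw [adjMatrix_hamming_mulVec, lineSums_fst, lineSums_snd]
      simp only [← Finset.mul_sum, ← Finset.sum_mul, hf, Pi.smul_apply, smul_eq_mul]
      ring
  · intro θ hθ
    rw [mem_spectrum_iff_exists_mulVec] at hθ
    obtain ⟨v, hv, h⟩ := hθ
    have h1 : v ⬝ᵥ ((hamming X).adjMatrix ℝ *ᵥ v) = ∑ i, (lineSums X v).1 i ^ 2 +
        ∑ j, (lineSums X v).2 j ^ 2 - 2 * (v ⬝ᵥ v) := by
      simp only [dotProduct, Fintype.sum_prod_type, adjMatrix_hamming_mulVec, mul_sub, mul_add,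
        Finset.sum_sub_distrib, Finset.sum_add_distrib]
      congr 1
      · congr 1
        · refine Finset.sum_congr rfl fun i _ => ?_
          rw [← Finset.sum_mul, ← lineSums_fst, sq]
        · rw [Finset.sum_comm]
          refine Finset.sum_congr rfl fun j _ => ?_
          rw [← Finset.sum_mul, ← lineSums_snd, sq]
      · simp only [Finset.mul_sum, mul_left_comm]
    rw [h, dotProduct_smul, smul_eq_mul] at h1
    have h2 : 0 < v ⬝ᵥ v := by
      refine lt_of_le_of_ne (Finset.sum_nonneg fun u _ => mul_self_nonneg _) (Ne.symm ?_)
      exact fun h0 => hv (dotProduct_self_eq_zero.mp h0)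
    have h3 : 0 ≤ ∑ i, (lineSums X v).1 i ^ 2 := Finset.sum_nonneg fun i _ => sq_nonneg _
    have h4 : 0 ≤ ∑ i, (lineSums X v).2 i ^ 2 := Finset.sum_nonneg fun i _ => sq_nonneg _
    have h5 : 0 ≤ (θ + 2) * (v ⬝ᵥ v) := by linarith
    linarith [nonneg_of_mul_nonneg_left h5 h2]

/-- The valency is `2 (m - 1)` and the smallest eigenvalue is `-2`, so the clique bound is `m`. -/
theorem isDelsarteClique_hamming_iff (hX : 2 ≤ Fintype.card X) (C : Finset (X × X)) :
    IsDelsarteClique (hamming X) C ↔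
      (hamming X).IsClique (C : Set (X × X)) ∧ C.card = Fintype.card X := by
  classical
  unfold IsDelsarteClique
  refine and_congr_right fun _ => ?_
  have : Nonempty X := Fintype.card_pos_iff.mp (by omega)
  obtain ⟨o⟩ := ‹Nonempty X›
  constructor
  · rintro ⟨k, θ, hk, hθ, hc⟩
    have h1 := hamming_degree (o, o)
    rw [hk (o, o)] at h1
    rw [hθ.unique
      (@isLeast_spectrum_hamming X _ (fun _ _ => Classical.propDecidable _) _ hX), h1] at hc
    have : (C.card : ℝ) = (Fintype.card X : ℝ) := by rw [hc]; ring
    exact_mod_cast this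
  · intro h
    refine ⟨2 * Fintype.card X - 2, -2, fun u => ?_,
      @isLeast_spectrum_hamming X _ (fun _ _ => Classical.propDecidable _) _ hX, ?_⟩
    · have h1 := hamming_degree u
      have h2 : (hamming X).degree u + 2 = 2 * Fintype.card X := by
        have : (((hamming X).degree u + 2 : ℕ) : ℝ) = ((2 * Fintype.card X : ℕ) : ℝ) := by
          push_cast; rw [h1]; ring
        exact_mod_cast this
      omega
    · rw [h, Nat.cast_sub (by omega)]
      push_cast; ring

theorem isClique_row (i : X) :
    (hamming X).IsClique ((({i} : Finset X) ×ˢ Finset.univ : Finset (X × X)) : Set (X × X)) := by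
  rintro ⟨a, b⟩ hu ⟨c, d⟩ hv hne
  simp only [Finset.coe_product, Finset.coe_singleton, Set.mem_prod, Set.mem_singleton_iff] at hu hv
  exact Or.inl ⟨hu.1.trans hv.1.symm,
    fun h => hne (Prod.ext (hu.1.trans hv.1.symm) h)⟩

theorem isClique_col (j : X) :
    (hamming X).IsClique ((Finset.univ ×ˢ ({j} : Finset X) : Finset (X × X)) : Set (X × X)) := by
  rintro ⟨a, b⟩ hu ⟨c, d⟩ hv hne
  simp only [Finset.coe_product, Finset.coe_singleton, Set.mem_prod, Set.mem_singleton_iff] at hu hv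
  exact Or.inr ⟨fun h => hne (Prod.ext h (hu.2.trans hv.2.symm)), hu.2.trans hv.2.symm⟩

/-- A clique with two vertices in a common row lies in that row. -/
theorem isClique_subset_line {C : Finset (X × X)}
    (h : (hamming X).IsClique (C : Set (X × X))) {u v : X × X} (hu : u ∈ C) (hv : v ∈ C)
    (huv : u ≠ v) :
    C ⊆ {u.1} ×ˢ Finset.univ ∨ C ⊆ Finset.univ ×ˢ {u.2} := by
  obtain ⟨h1, h2⟩ | ⟨h1, h2⟩ := h hu hv huv
  · refine Or.inl fun w hw => ?_
    simp only [Finset.mem_product, Finset.mem_singleton, Finset.mem_univ, and_true]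
    by_contra hne
    have e1 : w.2 = u.2 := by
      rcases h hw hu (fun e => hne (congrArg _ e)) with h3 | h3
      · exact absurd h3.1 hne
      · exact h3.2
    have e2 : w.2 = v.2 := by
      rcases h hw hv (fun e => hne ((congrArg _ e).trans h1.symm)) with h3 | h3
      · exact absurd (h3.1.trans h1.symm) hne
      · exact h3.2
    exact h2 (e1.symm.trans e2)
  · refine Or.inr fun w hw => ?_
    simp only [Finset.mem_product, Finset.mem_singleton, Finset.mem_univ, true_and]
    by_contra hne
    have e1 : w.1 = u.1 := by
      rcases h hw hu (fun e => hne (congrArg _ e)) with h3 | h3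
      · exact h3.1
      · exact absurd h3.2 hne
    have e2 : w.1 = v.1 := by
      rcases h hw hv (fun e => hne ((congrArg _ e).trans h2.symm)) with h3 | h3
      · exact h3.1
      · exact absurd (h3.2.trans h2.symm) hne
    exact h1 (e1.symm.trans e2)

theorem isDelsarteClique_hamming_iff_line (hX : 2 ≤ Fintype.card X) (C : Finset (X × X)) :
    IsDelsarteClique (hamming X) C ↔
      ∃ i, C = {i} ×ˢ Finset.univ ∨ C = Finset.univ ×ˢ {i} := by
  rw [isDelsarteClique_hamming_iff hX]
  constructor
  · rintro ⟨h, hc⟩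
    obtain ⟨u, hu, v, hv, huv⟩ := Finset.one_lt_card.mp (by omega : 1 < C.card)
    rcases isClique_subset_line h hu hv huv with h1 | h1
    · exact ⟨u.1, Or.inl (Finset.eq_of_subset_of_card_le h1 (by simp [hc]))⟩
    · exact ⟨u.2, Or.inr (Finset.eq_of_subset_of_card_le h1 (by simp [hc]))⟩
  · rintro ⟨i, rfl | rfl⟩
    · exact ⟨isClique_row i, by simp⟩
    · exact ⟨isClique_col i, by simp⟩

theorem isDelsarteClique_iff_isUnionOfLines (hX : 2 ≤ Fintype.card X) (C : Finset (X × X)) :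
    IsDelsarteClique (hamming X) C ↔ IsUnionOfLines 1 C := by
  rw [isDelsarteClique_hamming_iff_line hX]
  constructor
  · rintro ⟨i, h⟩
    exact ⟨{i}, Finset.card_singleton i, h⟩
  · rintro ⟨T, hT, h⟩
    obtain ⟨i, rfl⟩ := Finset.card_eq_one.mp hT
    exact ⟨i, h⟩

/-- Disjoint Delsarte cliques are parallel, as a row meets every column. -/
theorem isDisjointUnionOfDelsarteCliques_iff (hX : 2 ≤ Fintype.card X) (s : ℕ)
    (U : Finset (X × X)) :
    IsDisjointUnionOfDelsarteCliques (hamming X) s U ↔ IsUnionOfLines s U := by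
  classical
  have : Nonempty X := Fintype.card_pos_iff.mp (by omega)
  have hrow : Function.Injective
      fun i : X => (({i} : Finset X) ×ˢ Finset.univ : Finset (X × X)) := by
    intro i j (h : ({i} : Finset X) ×ˢ (Finset.univ : Finset X) = {j} ×ˢ Finset.univ)
    have : (i, i) ∈ (({j} : Finset X) ×ˢ Finset.univ : Finset (X × X)) := by rw [← h]; simp
    simpa [eq_comm] using this
  have hcol : Function.Injective
      fun i : X => (Finset.univ ×ˢ ({i} : Finset X) : Finset (X × X)) := by
    intro i j (h : (Finset.univ : Finset X) ×ˢ ({i} : Finset X) = Finset.univ ×ˢ {j})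
    have : (i, i) ∈ (Finset.univ ×ˢ ({j} : Finset X) : Finset (X × X)) := by rw [← h]; simp
    simpa [eq_comm] using this
  constructor
  · rintro ⟨𝒞, hs, hC, hdis, hU⟩
    by_cases hall : ∀ C ∈ 𝒞, ∃ i, C = {i} ×ˢ Finset.univ
    · have himg : 𝒞 = (Finset.univ.filter fun i : X => {i} ×ˢ Finset.univ ∈ 𝒞).image
          fun i : X => (({i} : Finset X) ×ˢ Finset.univ : Finset (X × X)) := by
        ext C
        simp only [Finset.mem_image, Finset.mem_filter, Finset.mem_univ, true_and]
        constructor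
        · intro h
          obtain ⟨i, rfl⟩ := hall C h
          exact ⟨i, h, rfl⟩
        · rintro ⟨i, h, rfl⟩; exact h
      refine ⟨Finset.univ.filter fun i : X => {i} ×ˢ Finset.univ ∈ 𝒞, ?_, Or.inl ?_⟩
      · rw [← hs, ← Finset.card_image_of_injective _ hrow, ← himg]
      · ext ⟨i, j⟩
        rw [hU]
        simp only [Finset.mem_product, Finset.mem_filter, Finset.mem_univ, true_and, and_true]
        constructor
        · rintro ⟨C, h, hm⟩
          obtain ⟨k, rfl⟩ := hall C h
          simp only [Finset.mem_product, Finset.mem_singleton, Finset.mem_univ, and_true] at hm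
          rwa [hm]
        · exact fun h => ⟨_, h, by simp⟩
    · push Not at hall
      obtain ⟨C₀, hC₀, hn⟩ := hall
      obtain ⟨l, h0 | h0⟩ := (isDelsarteClique_hamming_iff_line hX C₀).mp (hC C₀ hC₀)
      · exact absurd h0 (hn l)
      have hall : ∀ C ∈ 𝒞, ∃ i, C = Finset.univ ×ˢ {i} := by
        intro C h
        obtain ⟨i, h1 | h1⟩ := (isDelsarteClique_hamming_iff_line hX C).mp (hC C h)
        · by_cases he : C = C₀
          · exact ⟨l, he.trans h0⟩
          · have h2 := hdis h hC₀ he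
            have h3 : Disjoint C C₀ := h2
            refine absurd (Finset.disjoint_left.mp h3 (?_ : (i, l) ∈ C)) ?_
            · rw [h1]; simp
            · rw [h0]; simp
        · exact ⟨i, h1⟩
      have himg : 𝒞 = (Finset.univ.filter fun i : X => Finset.univ ×ˢ {i} ∈ 𝒞).image
          fun i : X => (Finset.univ ×ˢ ({i} : Finset X) : Finset (X × X)) := by
        ext C
        simp only [Finset.mem_image, Finset.mem_filter, Finset.mem_univ, true_and]
        constructor
        · intro h
          obtain ⟨i, rfl⟩ := hall C h
          exact ⟨i, h, rfl⟩
        · rintro ⟨i, h, rfl⟩; exact h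
      refine ⟨Finset.univ.filter fun i : X => Finset.univ ×ˢ {i} ∈ 𝒞, ?_, Or.inr ?_⟩
      · rw [← hs, ← Finset.card_image_of_injective _ hcol, ← himg]
      · ext ⟨i, j⟩
        rw [hU]
        simp only [Finset.mem_product, Finset.mem_filter, Finset.mem_univ, true_and]
        constructor
        · rintro ⟨C, h, hm⟩
          obtain ⟨k, rfl⟩ := hall C h
          simp only [Finset.mem_product, Finset.mem_singleton, Finset.mem_univ, true_and] at hm
          rwa [hm]
        · exact fun h => ⟨_, h, by simp⟩
  · rintro ⟨T, hT, rfl | rfl⟩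
    · refine ⟨T.image fun i => {i} ×ˢ Finset.univ, ?_, ?_, ?_, ?_⟩
      · rw [Finset.card_image_of_injective _ hrow, hT]
      · simp only [Finset.mem_image]
        rintro _ ⟨i, -, rfl⟩
        exact (isDelsarteClique_hamming_iff_line hX _).mpr ⟨i, Or.inl rfl⟩
      · intro A hA B hB hAB
        simp only [Finset.coe_image, Set.mem_image] at hA hB
        obtain ⟨i, -, rfl⟩ := hA
        obtain ⟨j, -, rfl⟩ := hB
        have hij : i ≠ j := fun e => hAB (by rw [e])
        refine Finset.disjoint_left.mpr fun w h1 h2 => hij ?_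
        simp only [id, Finset.mem_product, Finset.mem_singleton] at h1 h2
        exact h1.1.symm.trans h2.1
      · rintro ⟨i, j⟩
        simp
    · refine ⟨T.image fun i => Finset.univ ×ˢ {i}, ?_, ?_, ?_, ?_⟩
      · rw [Finset.card_image_of_injective _ hcol, hT]
      · simp only [Finset.mem_image]
        rintro _ ⟨i, -, rfl⟩
        exact (isDelsarteClique_hamming_iff_line hX _).mpr ⟨i, Or.inr rfl⟩
      · intro A hA B hB hAB
        simp only [Finset.coe_image, Set.mem_image] at hA hB
        obtain ⟨i, -, rfl⟩ := hA
        obtain ⟨j, -, rfl⟩ := hB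
        have hij : i ≠ j := fun e => hAB (by rw [e])
        refine Finset.disjoint_left.mpr fun w h1 h2 => hij ?_
        simp only [id, Finset.mem_product, Finset.mem_singleton] at h1 h2
        exact h1.2.symm.trans h2.2
      · rintro ⟨i, j⟩
        simp

end

section

/-! ### The threshold -/

/-- `(m - 2) (m - 4) = (m - 3)² - 1` is not a square. -/
theorem no_integer_solution {m : ℕ} (hm : 5 ≤ m) (k : ℤ) :
    ((m : ℤ) - 2) * k ^ 2 ≠ (m : ℤ) ^ 2 * ((m : ℤ) - 4) := by
  intro h
  have hm' : (5 : ℤ) ≤ m := by exact_mod_cast hm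
  set n : ℤ := ((m : ℕ) : ℤ)
  have h1 : ((n - 2) * k) ^ 2 = n ^ 2 * ((n - 2) * (n - 4)) := by linear_combination (n - 2) * h
  have h2 : n ∣ (n - 2) * k := by
    rw [← Int.pow_dvd_pow_iff (two_ne_zero)]
    exact ⟨_, h1⟩
  obtain ⟨j, hj⟩ := h2
  rw [hj, mul_pow] at h1
  have h3 : j ^ 2 = (n - 2) * (n - 4) := mul_left_cancel₀ (pow_ne_zero 2 (by omega)) h1
  have h4 : |j| < n - 3 := abs_lt_of_sq_lt_sq (by nlinarith) (by omega)
  have h5 : n - 4 < |j| := by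
    have := abs_lt_of_sq_lt_sq' (a := n - 4) (b := |j|) (by rw [sq_abs]; nlinarith) (abs_nonneg j)
    exact this.2
  omega

theorem eq_zero_of_critical {m : ℕ} (hm : 3 ≤ m) (s : ℕ)
    (h : ((m : ℝ) - 2) * ((m : ℝ) - 2 * s) ^ 2 = (m : ℝ) ^ 2 * ((m : ℝ) - 4)) :
    (m : ℝ) - 2 * s = 0 := by
  rcases Nat.lt_or_ge m 5 with h5 | h5
  · obtain rfl | rfl : m = 3 ∨ m = 4 := by omega
    · norm_num at h
      nlinarith [sq_nonneg ((3 : ℝ) - 2 * s)]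
    · norm_num at h
      exact_mod_cast h
  · exfalso
    apply no_integer_solution h5 ((m : ℤ) - 2 * s)
    exact_mod_cast h

theorem threshold_sq {m : ℕ} (hm : 5 ≤ m) : 0 ≤ (m : ℝ) - 2 * threshold m ∧
    ((m : ℝ) - 2) * ((m : ℝ) - 2 * threshold m) ^ 2 = (m : ℝ) ^ 2 * ((m : ℝ) - 4) := by
  have hm' : (5 : ℝ) ≤ m := by exact_mod_cast hm
  have h0 : 0 ≤ ((m : ℝ) - 4) / ((m : ℝ) - 2) := div_nonneg (by linarith) (by linarith)
  have h2 : (m : ℝ) - 2 ≠ 0 := by linarith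
  have e : (m : ℝ) - 2 * threshold m = m * √(((m : ℝ) - 4) / ((m : ℝ) - 2)) := by
    unfold threshold; ring
  rw [e]
  refine ⟨by positivity, ?_⟩
  rw [mul_pow, Real.sq_sqrt h0]
  field_simp

theorem lt_threshold_iff {m : ℕ} (hm : 5 ≤ m) {s : ℕ} (hs : 2 * s ≤ m) : (s : ℝ) < threshold m ↔
    (m : ℝ) ^ 2 * ((m : ℝ) - 4) < ((m : ℝ) - 2) * ((m : ℝ) - 2 * s) ^ 2 := by
  obtain ⟨h0, h⟩ := threshold_sq hm
  have hm' : (5 : ℝ) ≤ m := by exact_mod_cast hm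
  have hs' : 2 * (s : ℝ) ≤ m := by exact_mod_cast hs
  rw [← h, mul_lt_mul_iff_right₀ (by linarith), sq_lt_sq₀ h0 (by linarith)]
  constructor <;> intro h <;> linarith

theorem threshold_lt_iff {m : ℕ} (hm : 5 ≤ m) {s : ℕ} (hs : 2 * s ≤ m) : threshold m < (s : ℝ) ↔
    ((m : ℝ) - 2) * ((m : ℝ) - 2 * s) ^ 2 < (m : ℝ) ^ 2 * ((m : ℝ) - 4) := by
  obtain ⟨h0, h⟩ := threshold_sq hm
  have hm' : (5 : ℝ) ≤ m := by exact_mod_cast hm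
  have hs' : 2 * (s : ℝ) ≤ m := by exact_mod_cast hs
  rw [← h, mul_lt_mul_iff_right₀ (by linarith), sq_lt_sq₀ (by linarith) h0]
  constructor <;> intro h <;> linarith

theorem threshold_pos {m : ℕ} (hm : 5 ≤ m) : 0 < threshold m := by
  have hm' : (5 : ℝ) ≤ m := by exact_mod_cast hm
  have := (lt_threshold_iff hm (s := 0) (by omega)).mpr (by push_cast; nlinarith)
  exact_mod_cast this

theorem threshold_lt_half {m : ℕ} (hm : 5 ≤ m) : threshold m < ((m / 2 : ℕ) : ℝ) := by
  have hm' : (5 : ℝ) ≤ m := by exact_mod_cast hm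
  rw [threshold_lt_iff hm (by omega)]
  have h1 : (m : ℝ) - 2 * ((m / 2 : ℕ) : ℝ) = ((m % 2 : ℕ) : ℝ) := by
    have : (m : ℝ) = ((m % 2 + 2 * (m / 2) : ℕ) : ℝ) := by rw [Nat.mod_add_div]
    push_cast at this
    linarith
  have h2 : ((m % 2 : ℕ) : ℝ) ^ 2 ≤ 1 := by
    rcases Nat.mod_two_eq_zero_or_one m with h | h <;> rw [h] <;> norm_num
  rw [h1]
  nlinarith [mul_nonneg (by linarith : 0 ≤ (m : ℝ) - 2) (sub_nonneg.mpr h2),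
    mul_nonneg (sq_nonneg (m : ℝ)) (by linarith : 0 ≤ (m : ℝ) - 5)]

theorem threshold_ne_int {m : ℕ} (hm : 5 ≤ m) (k : ℤ) : threshold m ≠ k := by
  intro e
  have h := (threshold_sq hm).2
  rw [e] at h
  apply no_integer_solution hm ((m : ℤ) - 2 * k)
  exact_mod_cast h

/-! ### Representations with distances `1, 2` -/

section OneTwo

variable {X : Type*} [Fintype X]

/-- The dimension of the kernel of the form for the distances `1, 2`. -/
local notation "κ" => finrank ℝ (LinearMap.ker (distOp (hamming X) 1 2))

theorem finrank_rad_one_two_rows_le (hX : 3 ≤ Fintype.card X) (T : Finset X) :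
    finrank ℝ (rad (hamming X) (T ×ˢ Finset.univ) 1 2) ≤ κ := by
  have : Nonempty X := Fintype.card_pos_iff.mp (by omega)
  exact Submodule.finrank_mono (rad_rows_le T (eq_zero_of_critical hX T.card))

theorem isUnionOfLines_of_ker_le {U : Finset (X × X)}
    (h : LinearMap.ker (distOp (hamming X) 1 2) ≤ signPerp U) : ∃ s, IsUnionOfLines s U :=
  exists_isUnionOfLines ((ker_lineSums_le X).trans h)

theorem card_le_of_representable_one_two (hX : 3 ≤ Fintype.card X) {U : Finset (X × X)} {p q : ℕ}
    (h : Representable (switching (hamming X) U) 1 2 p q) :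
    Fintype.card (X × X) ≤ p + q + κ + 1 := by
  have : Nonempty X := Fintype.card_pos_iff.mp (by omega)
  by_cases hU : LinearMap.ker (distOp (hamming X) 1 2) ≤ signPerp U
  · obtain ⟨s, hs⟩ := isUnionOfLines_of_ker_le hU
    obtain ⟨T, -, hT⟩ := hs.exists_rows
    have h1 := (hT _ _ _ _ h).finrank_signPerp_le
    have h2 := finrank_rad_one_two_rows_le hX T
    have h3 := finrank_signPerp (T ×ˢ Finset.univ : Finset (X × X))
    omega
  · have h1 := h.finrank_signPerp_le
    have h2 := finrank_rad_lt hU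
    have h3 := finrank_signPerp U
    omega

theorem ker_le_signPerp_of_representable (hX : 3 ≤ Fintype.card X) {U : Finset (X × X)} {p q : ℕ}
    (h : Representable (switching (hamming X) U) 1 2 p q)
    (hpq : p + q + κ + 1 = Fintype.card (X × X)) :
    LinearMap.ker (distOp (hamming X) 1 2) ≤ signPerp U := by
  have : Nonempty X := Fintype.card_pos_iff.mp (by omega)
  by_contra hU
  have h1 := h.finrank_signPerp_le
  have h2 := finrank_rad_lt hU
  have h3 := finrank_signPerp U
  omega

theorem exists_representable_one_two (hX : 3 ≤ Fintype.card X) {U : Finset (X × X)}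
    (hU : LinearMap.ker (distOp (hamming X) 1 2) ≤ signPerp U) :
    ∃ p q, Representable (switching (hamming X) U) 1 2 p q ∧
      p + q + κ + 1 = Fintype.card (X × X) := by
  have : Nonempty X := Fintype.card_pos_iff.mp (by omega)
  obtain ⟨p, q, h, hpq⟩ := exists_representable (hamming X) U 1 2
  have h1 : κ ≤ finrank ℝ (rad (hamming X) U 1 2) :=
    Submodule.finrank_mono ((le_inf le_rfl hU).trans (ker_inf_signPerp_le_rad _ _ _ _))
  have h2 := finrank_signPerp U
  have h3 := card_le_of_representable_one_two hX h
  exact ⟨p, q, h, by omega⟩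

theorem card_le_of_nonneg (hX : 3 ≤ Fintype.card X) {s : ℕ} {U : Finset (X × X)}
    (hU : IsUnionOfLines s U) {p q : ℕ} (h : Representable (switching (hamming X) U) 1 2 p q)
    (hs : (Fintype.card X : ℝ) ^ 2 * ((Fintype.card X : ℝ) - 4) ≤
      ((Fintype.card X : ℝ) - 2) * ((Fintype.card X : ℝ) - 2 * s) ^ 2) :
    Fintype.card (X × X) ≤ p + κ + 1 := by
  have : Nonempty X := Fintype.card_pos_iff.mp (by omega)
  obtain ⟨T, rfl, hT⟩ := hU.exists_rows
  have h1 := (hT _ _ _ _ h).finrank_le_of_nonneg le_rfl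
    (fun y hy => nonneg_rows T (by omega) hs hy)
  have h2 := finrank_rad_one_two_rows_le hX T
  have h3 := finrank_signPerp (T ×ˢ Finset.univ : Finset (X × X))
  omega

/-- Below the critical value the form is still nonnegative on the hyperplane of vectors with
total `0`, so exactly one coordinate is negative. -/
theorem card_le_of_neg (hX : 5 ≤ Fintype.card X) {s : ℕ} {U : Finset (X × X)}
    (hU : IsUnionOfLines s U) {p q : ℕ} (h : Representable (switching (hamming X) U) 1 2 p q)
    (hs : ((Fintype.card X : ℝ) - 2) * ((Fintype.card X : ℝ) - 2 * s) ^ 2 <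
      (Fintype.card X : ℝ) ^ 2 * ((Fintype.card X : ℝ) - 4)) :
    Fintype.card (X × X) ≤ p + κ + 2 ∧ 0 < q := by
  have : Nonempty X := Fintype.card_pos_iff.mp (by omega)
  obtain ⟨T, rfl, hT⟩ := hU.exists_rows
  have hr := hT _ _ _ _ h
  obtain ⟨y, hy, hneg⟩ := exists_neg_rows T hX hs
  refine ⟨?_, hr.pos_of_neg hy hneg⟩
  have h1 := hr.finrank_le_of_nonneg (A := signPerp _ ⊓ LinearMap.ker (total X)) inf_le_left
    (fun y hy => by
      rw [dotProduct_distOp_one_two, LinearMap.mem_ker.mp hy.2]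
      have h3 : 0 ≤ ∑ i, (lineSums X y).1 i ^ 2 := Finset.sum_nonneg fun i _ => sq_nonneg _
      have h4 : 0 ≤ ∑ i, (lineSums X y).2 i ^ 2 := Finset.sum_nonneg fun i _ => sq_nonneg _
      linarith)
  have h2 := finrank_rad_one_two_rows_le (by omega) T
  have h3 := finrank_signPerp (T ×ˢ Finset.univ : Finset (X × X))
  have h4 := finrank_le_add_of_ker (total X) (A := signPerp (T ×ˢ Finset.univ : Finset (X × X)))
    (R := signPerp _ ⊓ LinearMap.ker (total X)) fun y hy h0 => ⟨hy, h0⟩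
  rw [finrank_self] at h4
  omega

theorem finrank_ker_lineSums_le : finrank ℝ (LinearMap.ker (lineSums X)) ≤ κ :=
  Submodule.finrank_mono (ker_lineSums_le X)

theorem ker_lineSums_inf_le_rad (U : Finset (X × X)) :
    LinearMap.ker (lineSums X) ⊓ signPerp U ≤ rad (hamming X) U 1 2 :=
  (inf_le_inf_right _ (ker_lineSums_le X)).trans (ker_inf_signPerp_le_rad _ _ _ _)

/-- For `m ≥ 4` the form for distances not proportional to `1, 2` has a larger rank. -/
theorem card_lt_of_not_proportional (hX : 4 ≤ Fintype.card X) {U : Finset (X × X)} {a b : ℝ}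
    (hab : b ≠ 2 * a) {p q : ℕ} (h : Representable (switching (hamming X) U) a b p q) :
    Fintype.card (X × X) < p + q + κ + 1 := by
  have : Nonempty X := Fintype.card_pos_iff.mp (by omega)
  have h1 := finrank_add_le_of_disjoint (A := rad (hamming X) U a b)
    (B := LinearMap.ker (lineSums X) ⊓ signPerp U) (C := signPerp U)
    (disjoint_of_dotProduct fun x hx y hy =>
      dotProduct_eq_zero_of_mem_rad (by intro e; apply hab; linarith) hx
        (ker_lineSums_inf_le_rad U hy)) (rad_le _ _ _ _) inf_le_right
  have h2 := h.finrank_signPerp_le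
  have h3 := finrank_signPerp U
  have h4 := finrank_le_finrank_inf_signPerp U (LinearMap.ker (lineSums X))
  have h5 := finrank_ker_lineSums (X := X)
  have h6 := finrank_ker_lineSums_le (X := X)
  have h7 : 4 * Fintype.card X ≤ Fintype.card X * Fintype.card X := Nat.mul_le_mul_right _ hX
  rw [Fintype.card_prod] at *
  omega

/-- The minimum dimensionality, provided that other distances do no better than `1, 2`. -/
theorem isMinDimensionality_of_bound (hX : 3 ≤ Fintype.card X) {d : ℕ}
    (hd : d + κ + 1 = Fintype.card (X × X)) {U₀ : Finset (X × X)}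
    (hU₀ : LinearMap.ker (distOp (hamming X) 1 2) ≤ signPerp U₀)
    (hbound : ∀ (U : Finset (X × X)) (a b : ℝ) (p q : ℕ), a ≠ b → b ≠ 2 * a →
      Representable (switching (hamming X) U) a b p q → d ≤ p + q) :
    IsMinDimensionality (hamming X) d := by
  have : Nontrivial X := Fintype.one_lt_card_iff_nontrivial.mp (by omega)
  constructor
  · obtain ⟨p, q, h, hpq⟩ := exists_representable_one_two hX hU₀
    exact ⟨_, ⟨U₀, rfl⟩, 1, 2, p, q, admissible_of_ne_zero _ (by norm_num) (by norm_num)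
      (by norm_num), h, by omega⟩
  · rintro n ⟨H, ⟨U, rfl⟩, a, b, p, q, hadm, h, rfl⟩
    by_cases hab : b = 2 * a
    · have ha : a ≠ 0 := by
        rintro rfl
        exact hadm.1 (by linarith)
      obtain ⟨p₀, q₀, e, h', -⟩ := Representable.of_mul (a₀ := 1) (b₀ := 2) ha
        (by rwa [mul_one, mul_comm a 2, ← hab])
      have := card_le_of_representable_one_two hX h'
      omega
    · exact hbound U a b p q hadm.1 hab h

/-- The minimal representations with distances proportional to `1, 2`. -/
theorem attains_one_two (hX : 3 ≤ Fintype.card X) {d : ℕ}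
    (hd : d + κ + 1 = Fintype.card (X × X)) {U : Finset (X × X)} {a b : ℝ} {p q : ℕ}
    (hab : b = 2 * a) (h : Attains (hamming X) U a b p q)
    (hmin : IsMinDimensionality (hamming X) d) :
    LinearMap.ker (distOp (hamming X) 1 2) ≤ signPerp U ∧ ∃ p₀ q₀, p₀ + q₀ = d ∧
      Representable (switching (hamming X) U) 1 2 p₀ q₀ ∧ UpToScaling a b p q 1 2 p₀ q₀ := by
  obtain ⟨hadm, hrep, hpq⟩ := h
  have ha : a ≠ 0 := by
    rintro rfl
    exact hadm.1 (by linarith)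
  have e := hpq.unique hmin
  obtain ⟨p₀, q₀, e', h', hs⟩ := Representable.of_mul (a₀ := 1) (b₀ := 2) ha
    (by rwa [mul_one, mul_comm a 2, ← hab])
  rw [mul_one, mul_comm a 2, ← hab] at hs
  exact ⟨ker_le_signPerp_of_representable hX h' (by omega), p₀, q₀, by omega, h', hs⟩

theorem attains_of_upToScaling (hX : 3 ≤ Fintype.card X) {U : Finset (X × X)} {a b a₀ b₀ : ℝ}
    {p q p₀ q₀ : ℕ} (hab : a₀ ≠ b₀) (ha : a₀ ≠ 0) (hb : b₀ ≠ 0)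
    (h : Representable (switching (hamming X) U) a₀ b₀ p₀ q₀)
    (hmin : IsMinDimensionality (hamming X) (p₀ + q₀)) (hs : UpToScaling a b p q a₀ b₀ p₀ q₀) :
    Attains (hamming X) U a b p q := by
  have : Nontrivial X := Fintype.one_lt_card_iff_nontrivial.mp (by omega)
  refine ⟨(admissible_of_ne_zero _ hab ha hb).of_upToScaling hs, h.of_upToScaling hs, ?_⟩
  rwa [hs.add_eq]

end OneTwo

end

section

variable {X : Type*} [Fintype X]

/-! ### Unions of a given number of lines -/

theorem exists_isUnionOfLines_of_le {s : ℕ} (hs : s ≤ Fintype.card X) :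
    ∃ U : Finset (X × X), IsUnionOfLines s U := by
  obtain ⟨T, -, hT⟩ := Finset.exists_subset_card_eq (s := (Finset.univ : Finset X)) hs
  exact ⟨_, T, hT, Or.inl rfl⟩

theorem IsUnionOfLines.eq_empty {U : Finset (X × X)} (h : IsUnionOfLines 0 U) : U = ∅ := by
  have := h.card_eq
  rw [zero_mul] at this
  exact Finset.card_eq_zero.mp this

theorem isUnionOfLines_empty : IsUnionOfLines 0 (∅ : Finset (X × X)) :=
  ⟨∅, Finset.card_empty, Or.inl (by simp)⟩

theorem ker_le_signPerp (h4 : Fintype.card X ≠ 4) [Nonempty X] {s : ℕ} {U : Finset (X × X)}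
    (h : IsUnionOfLines s U) : LinearMap.ker (distOp (hamming X) 1 2) ≤ signPerp U := by
  rw [ker_distOp_eq h4]
  exact ker_lineSums_le_signPerp h

/-! ### The case `m ≥ 5` -/

section LargeCard

theorem finrank_ker_distOp_add (h4 : Fintype.card X ≠ 4) [Nonempty X] :
    finrank ℝ (LinearMap.ker (distOp (hamming X) 1 2)) + 2 * Fintype.card X =
      Fintype.card (X × X) + 1 := by
  rw [ker_distOp_eq h4, finrank_ker_lineSums, Fintype.card_prod]

theorem isMinDimensionality_of_five_le (hX : 5 ≤ Fintype.card X) :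
    IsMinDimensionality (hamming X) (2 * Fintype.card X - 2) := by
  have : Nonempty X := Fintype.card_pos_iff.mp (by omega)
  have hκ := finrank_ker_distOp_add (X := X) (by omega)
  refine isMinDimensionality_of_bound (by omega) (by omega)
    (ker_le_signPerp (by omega) isUnionOfLines_empty) fun U a b p q _ hab h => ?_
  have := card_lt_of_not_proportional (by omega) hab h
  omega

/-- The signature of a minimal representation on the switching by `s` lines. -/
theorem signature_of_five_le (hX : 5 ≤ Fintype.card X) {s : ℕ} {U : Finset (X × X)}
    (hU : IsUnionOfLines s U) (hs : s ≤ Fintype.card X / 2) {p q : ℕ}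
    (h : Representable (switching (hamming X) U) 1 2 p q) (hpq : p + q = 2 * Fintype.card X - 2) :
    ((s : ℝ) < threshold (Fintype.card X) ∧ p = 2 * Fintype.card X - 2 ∧ q = 0) ∨
      (threshold (Fintype.card X) < (s : ℝ) ∧ p = 2 * Fintype.card X - 3 ∧ q = 1) := by
  have : Nonempty X := Fintype.card_pos_iff.mp (by omega)
  have hκ := finrank_ker_distOp_add (X := X) (by omega)
  have hs2 : 2 * s ≤ Fintype.card X := by omega
  have hne : threshold (Fintype.card X) ≠ (s : ℝ) := by
    have := threshold_ne_int hX (s : ℤ)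
    exact_mod_cast this
  rcases hne.lt_or_gt with ht | ht
  · have h1 := card_le_of_neg hX hU h ((threshold_lt_iff hX hs2).mp ht)
    exact Or.inr ⟨ht, by omega, by omega⟩
  · have h1 := card_le_of_nonneg (by omega) hU h ((lt_threshold_iff hX hs2).mp ht).le
    exact Or.inl ⟨ht, by omega, by omega⟩

theorem attains_iff_of_five_le (hX : 5 ≤ Fintype.card X) (U : Finset (X × X))
    (hU : 2 * U.card ≤ Fintype.card (X × X)) (a b : ℝ) (p q : ℕ) :
    Attains (hamming X) U a b p q ↔
      ∃ s : ℕ, s ≤ Fintype.card X / 2 ∧ IsUnionOfLines s U ∧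
        (((s : ℝ) < threshold (Fintype.card X) ∧
            UpToScaling a b p q 1 2 (2 * Fintype.card X - 2) 0) ∨
          (threshold (Fintype.card X) < (s : ℝ) ∧
            UpToScaling a b p q 1 2 (2 * Fintype.card X - 3) 1)) := by
  have : Nonempty X := Fintype.card_pos_iff.mp (by omega)
  have hκ := finrank_ker_distOp_add (X := X) (by omega)
  have hmin := isMinDimensionality_of_five_le hX
  constructor
  · intro h
    have hab : b = 2 * a := by
      by_contra hab
      have h1 := card_lt_of_not_proportional (by omega) hab h.2.1
      have h2 := h.2.2.unique hmin
      omega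
    obtain ⟨hker, p₀, q₀, e, hrep, hs⟩ :=
      attains_one_two (d := 2 * Fintype.card X - 2) (by omega) (by omega) hab h hmin
    obtain ⟨s, hlines⟩ := isUnionOfLines_of_ker_le hker
    have hsm : s ≤ Fintype.card X / 2 := by
      rw [hlines.card_eq, Fintype.card_prod, ← mul_assoc] at hU
      have := Nat.le_of_mul_le_mul_right hU (by omega)
      omega
    refine ⟨s, hsm, hlines, ?_⟩
    rcases signature_of_five_le hX hlines hsm hrep e with ⟨ht, rfl, rfl⟩ | ⟨ht, rfl, rfl⟩
    · exact Or.inl ⟨ht, hs⟩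
    · exact Or.inr ⟨ht, hs⟩
  · rintro ⟨s, hsm, hlines, h⟩
    obtain ⟨p₀, q₀, hrep, e⟩ := exists_representable_one_two (by omega)
      (ker_le_signPerp (by omega) hlines)
    have e' : p₀ + q₀ = 2 * Fintype.card X - 2 := by omega
    refine attains_of_upToScaling (p₀ := p₀) (q₀ := q₀) (by omega) (by norm_num : (1 : ℝ) ≠ 2)
      (by norm_num) (by norm_num) hrep (by rwa [e']) ?_
    rcases signature_of_five_le hX hlines hsm hrep e' with ⟨ht, rfl, rfl⟩ | ⟨ht, rfl, rfl⟩
    · rcases h with ⟨-, h⟩ | ⟨ht', -⟩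
      · exact h
      · exact absurd ht (lt_asymm ht')
    · rcases h with ⟨ht', -⟩ | ⟨-, h⟩
      · exact absurd ht (lt_asymm ht')
      · exact h

end LargeCard

/-! ### The case `m = 4` -/

section CardFour

theorem mem_signPerp_one_iff {s : ℕ} {U : Finset (X × X)} (hX : Fintype.card X = 4)
    (hU : IsUnionOfLines s U) : (1 : X × X → ℝ) ∈ signPerp U ↔ s = 2 := by
  have h := sum_signVec U
  rw [hU.card_eq, Fintype.card_prod, hX] at h
  push_cast at h
  simp only [mem_signPerp, Pi.one_apply, mul_one, h]
  constructor
  · intro h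
    have : (s : ℝ) = 2 := by linarith
    exact_mod_cast this
  · rintro rfl
    norm_num

theorem ker_le_signPerp_iff_of_card_eq_four (hX : Fintype.card X = 4) (U : Finset (X × X)) :
    LinearMap.ker (distOp (hamming X) 1 2) ≤ signPerp U ↔ IsUnionOfLines 2 U := by
  have : Nonempty X := Fintype.card_pos_iff.mp (by omega)
  constructor
  · intro h
    obtain ⟨s, hs⟩ := isUnionOfLines_of_ker_le h
    rwa [(mem_signPerp_one_iff hX hs).mp (h (one_mem_ker_distOp hX))] at hs
  · intro h y hy
    have h1 := (mem_signPerp_one_iff hX h).mpr rfl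
    have h2 : y - (total X y / 16) • (1 : X × X → ℝ) ∈ LinearMap.ker (lineSums X) := by
      refine ker_distOp_inf_ker_total ⟨sub_mem hy (Submodule.smul_mem _ _ (one_mem_ker_distOp hX)),
        ?_⟩
      rw [SetLike.mem_coe, LinearMap.mem_ker, map_sub, map_smul, total_apply 1]
      simp [hX]
      ring
    have h3 := add_mem (ker_lineSums_le_signPerp h h2)
      (Submodule.smul_mem _ (total X y / 16) h1)
    rwa [sub_add_cancel] at h3

theorem isMinDimensionality_of_card_eq_four (hX : Fintype.card X = 4) :
    IsMinDimensionality (hamming X) 5 := by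
  have hκ := finrank_ker_distOp_of_card_eq_four hX
  have hc : Fintype.card (X × X) = 16 := by rw [Fintype.card_prod, hX]
  obtain ⟨U₀, hU₀⟩ := exists_isUnionOfLines_of_le (X := X) (s := 2) (by omega)
  refine isMinDimensionality_of_bound (by omega) (by omega)
    ((ker_le_signPerp_iff_of_card_eq_four hX U₀).mpr hU₀) fun U a b p q _ hab h => ?_
  have := card_lt_of_not_proportional (by omega) hab h
  omega

theorem signature_of_card_eq_four (hX : Fintype.card X = 4) {U : Finset (X × X)}
    (hU : IsUnionOfLines 2 U) {p q : ℕ} (h : Representable (switching (hamming X) U) 1 2 p q)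
    (hpq : p + q = 5) : p = 5 ∧ q = 0 := by
  have hκ := finrank_ker_distOp_of_card_eq_four hX
  have hc : Fintype.card (X × X) = 16 := by rw [Fintype.card_prod, hX]
  have := card_le_of_nonneg (by omega) hU h (by rw [hX]; norm_num)
  omega

theorem attains_iff_of_card_eq_four (hX : Fintype.card X = 4) (U : Finset (X × X))
    (a b : ℝ) (p q : ℕ) :
    Attains (hamming X) U a b p q ↔ UpToScaling a b p q 1 2 5 0 ∧ IsUnionOfLines 2 U := by
  have hκ := finrank_ker_distOp_of_card_eq_four hX
  have hc : Fintype.card (X × X) = 16 := by rw [Fintype.card_prod, hX]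
  have hmin := isMinDimensionality_of_card_eq_four hX
  constructor
  · intro h
    have hab : b = 2 * a := by
      by_contra hab
      have h1 := card_lt_of_not_proportional (by omega) hab h.2.1
      have h2 := h.2.2.unique hmin
      omega
    obtain ⟨hker, p₀, q₀, e, hrep, hs⟩ :=
      attains_one_two (d := 5) (by omega) (by omega) hab h hmin
    have hU := (ker_le_signPerp_iff_of_card_eq_four hX U).mp hker
    obtain ⟨rfl, rfl⟩ := signature_of_card_eq_four hX hU hrep e
    exact ⟨hs, hU⟩
  · rintro ⟨hs, hU⟩
    obtain ⟨p₀, q₀, hrep, e⟩ := exists_representable_one_two (by omega)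
      ((ker_le_signPerp_iff_of_card_eq_four hX U).mpr hU)
    obtain ⟨rfl, rfl⟩ := signature_of_card_eq_four hX hU hrep (by omega)
    exact attains_of_upToScaling (by omega) (by norm_num) (by norm_num) (by norm_num) hrep hmin hs

end CardFour

/-! ### The case `m = 3` -/

section CardThree

/-- `H(2,3)` is self-complementary: over the field with three elements,
`(x, y) ↦ (x + y, x - y)` exchanges lines parallel to the axes with diagonal lines. -/
theorem exists_antiautomorphism (hX : Fintype.card X = 3) : ∃ e : X × X ≃ X × X,
    (∀ u v, u ≠ v → ((hamming X).Adj (e u) (e v) ↔ ¬(hamming X).Adj u v)) ∧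
    ∀ u v, u ≠ v → ((hamming X).Adj (e.symm u) (e.symm v) ↔ ¬(hamming X).Adj u v) := by
  let g : X ≃ Fin 3 := Fintype.equivFinOfCardEq hX
  let r : Fin 3 × Fin 3 ≃ Fin 3 × Fin 3 :=
    { toFun := fun w => (w.1 + w.2, w.1 - w.2)
      invFun := fun w => (2 * (w.1 + w.2), 2 * (w.1 - w.2))
      left_inv := by decide
      right_inv := by decide }
  have hr : ∀ u v : Fin 3 × Fin 3, u ≠ v →
      ((((r u).1 = (r v).1 ∧ (r u).2 ≠ (r v).2) ∨ ((r u).1 ≠ (r v).1 ∧ (r u).2 = (r v).2)) ↔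
        ¬((u.1 = v.1 ∧ u.2 ≠ v.2) ∨ (u.1 ≠ v.1 ∧ u.2 = v.2))) := by
    decide
  have hg : ∀ u v : X × X, (hamming X).Adj u v ↔
      ((g.prodCongr g u).1 = (g.prodCongr g v).1 ∧ (g.prodCongr g u).2 ≠ (g.prodCongr g v).2) ∨
      ((g.prodCongr g u).1 ≠ (g.prodCongr g v).1 ∧ (g.prodCongr g u).2 = (g.prodCongr g v).2) := by
    intro u v
    simp [hamming]
  let e : X × X ≃ X × X := ((g.prodCongr g).trans r).trans (g.prodCongr g).symm
  have he : ∀ u v, u ≠ v → ((hamming X).Adj (e u) (e v) ↔ ¬(hamming X).Adj u v) := by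
    intro u v huv
    have h1 : ∀ w, g.prodCongr g (e w) = r (g.prodCongr g w) := fun w =>
      (g.prodCongr g).apply_symm_apply _
    rw [hg (e u), hg u, h1, h1]
    exact hr _ _ ((g.prodCongr g).injective.ne huv)
  refine ⟨e, he, fun u v huv => ?_⟩
  have := he (e.symm u) (e.symm v) (e.symm.injective.ne huv)
  rw [e.apply_symm_apply, e.apply_symm_apply] at this
  rw [this, not_not]

theorem distOp_comp_antiautomorphism {V : Type*} [Fintype V] {G : SimpleGraph V} (e : V ≃ V)
    (he : ∀ u v, u ≠ v → (G.Adj (e u) (e v) ↔ ¬G.Adj u v)) (a b : ℝ) (y : V → ℝ) :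
    distOp G b a (y ∘ e) = distOp G a b y ∘ e := by
  classical
  have hs : ∀ u v, seidel G u v = -seidel G (e u) (e v) := by
    intro u v
    by_cases huv : u = v
    · simp [seidel, huv]
    · by_cases h : G.Adj u v <;> simp [seidel, huv, he u v huv, h]
  ext u
  have h : ∑ v, seidel G u v * y (e v) = -∑ v, seidel G (e u) v * y v := by
    rw [← e.sum_comp fun v => seidel G (e u) v * y v, ← Finset.sum_neg_distrib]
    exact Finset.sum_congr rfl fun v _ => by rw [hs, neg_mul]
  simp only [distOp_apply, Function.comp_apply, h]
  ring

/-- For `m = 3` the radicals for the distances `1, 2` and `2, 1` leave no room for a third large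
radical. -/
theorem four_lt_of_not_proportional (hX : Fintype.card X = 3) {U : Finset (X × X)} {a b : ℝ}
    (h12 : b ≠ 2 * a) (h21 : a ≠ 2 * b) {p q : ℕ}
    (h : Representable (switching (hamming X) U) a b p q) : 4 < p + q := by
  have : Nonempty X := Fintype.card_pos_iff.mp (by omega)
  have hc : Fintype.card (X × X) = 9 := by rw [Fintype.card_prod, hX]
  obtain ⟨e, he, -⟩ := exists_antiautomorphism hX
  have hZ := finrank_ker_lineSums (X := X)
  rw [hX] at hZ
  set Z := LinearMap.ker (lineSums X) with hZdef
  set W := Z.map (LinearEquiv.funCongrLeft ℝ ℝ e : (X × X → ℝ) →ₗ[ℝ] (X × X → ℝ)) with hWdef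
  have hW : finrank ℝ W = finrank ℝ Z := LinearEquiv.finrank_map_eq _ _
  have hWrad : W ⊓ signPerp U ≤ rad (hamming X) U 2 1 := by
    refine le_trans (inf_le_inf_right _ ?_) (ker_inf_signPerp_le_rad _ _ _ _)
    rintro _ ⟨y, hy, rfl⟩
    have hy := LinearMap.mem_ker.mp (ker_lineSums_le X hy)
    have h1 : distOp (hamming X) 2 1 (y ∘ e) = 0 := by
      rw [distOp_comp_antiautomorphism e he, hy]; rfl
    exact LinearMap.mem_ker.mpr h1
  have d1 : ∀ x ∈ rad (hamming X) U a b, ∀ y ∈ Z ⊓ signPerp U, x ⬝ᵥ y = 0 := fun x hx y hy =>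
    dotProduct_eq_zero_of_mem_rad (by intro e; apply h12; linarith) hx
      (ker_lineSums_inf_le_rad U hy)
  have d2 : ∀ x ∈ rad (hamming X) U a b, ∀ y ∈ W ⊓ signPerp U, x ⬝ᵥ y = 0 := fun x hx y hy =>
    dotProduct_eq_zero_of_mem_rad (by intro e; apply h21; linarith) hx (hWrad hy)
  have d3 : ∀ x ∈ Z ⊓ signPerp U, ∀ y ∈ W ⊓ signPerp U, x ⬝ᵥ y = 0 := fun x hx y hy =>
    dotProduct_eq_zero_of_mem_rad (by norm_num) (ker_lineSums_inf_le_rad U hx) (hWrad hy)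
  have d4 : ∀ x ∈ rad (hamming X) U a b ⊔ Z ⊓ signPerp U, ∀ y ∈ W ⊓ signPerp U, x ⬝ᵥ y = 0 := by
    intro x hx y hy
    obtain ⟨x₁, h1, x₂, h2, rfl⟩ := Submodule.mem_sup.mp hx
    rw [add_dotProduct, d2 _ h1 _ hy, d3 _ h2 _ hy, add_zero]
  have f1 := finrank_add_le_of_disjoint (disjoint_of_dotProduct d1) le_sup_left le_sup_right
  have f2 := finrank_add_le_of_disjoint (C := signPerp U) (disjoint_of_dotProduct d4)
    (sup_le (rad_le _ _ _ _) inf_le_right) inf_le_right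
  have f3 := finrank_le_finrank_inf_signPerp U Z
  have f4 := finrank_le_finrank_inf_signPerp U W
  have f5 := h.finrank_signPerp_le
  have f6 := finrank_signPerp U
  omega

theorem UpToScaling.swap {a b a₀ b₀ : ℝ} {p q p₀ q₀ : ℕ}
    (h : UpToScaling a b p q a₀ b₀ p₀ q₀) : UpToScaling b a p q b₀ a₀ p₀ q₀ := by
  obtain ⟨c, ha, hb, h⟩ := h
  exact ⟨c, hb, ha, h⟩

theorem finrank_ker_distOp_of_card_eq_three (hX : Fintype.card X = 3) :
    finrank ℝ (LinearMap.ker (distOp (hamming X) 1 2)) = 4 := by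
  have : Nonempty X := Fintype.card_pos_iff.mp (by omega)
  have hκ := finrank_ker_distOp_add (X := X) (by omega)
  rw [Fintype.card_prod, hX] at hκ
  omega

theorem Representable.map_symm_antiautomorphism {V : Type*} {G : SimpleGraph V} {e : V ≃ V}
    (he : ∀ u v, u ≠ v → (G.Adj (e u) (e v) ↔ ¬G.Adj u v)) {U : Finset V} {a b : ℝ} {p q : ℕ}
    (h : Representable (switching G U) a b p q) :
    Representable (switching G (U.map e.symm.toEmbedding)) b a p q := by
  apply Representable.map_antiautomorphism e he
  rwa [Finset.map_map, ← Equiv.trans_toEmbedding, Equiv.symm_trans_self, Equiv.refl_toEmbedding,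
    Finset.map_refl]

theorem isMinDimensionality_of_card_eq_three (hX : Fintype.card X = 3) :
    IsMinDimensionality (hamming X) 4 := by
  have : Nonempty X := Fintype.card_pos_iff.mp (by omega)
  have hκ := finrank_ker_distOp_of_card_eq_three hX
  have hc : Fintype.card (X × X) = 9 := by rw [Fintype.card_prod, hX]
  obtain ⟨e, he, -⟩ := exists_antiautomorphism hX
  refine isMinDimensionality_of_bound (by omega) (by omega)
    (ker_le_signPerp (by omega) isUnionOfLines_empty) fun U a b p q hne hab h => ?_
  by_cases h21 : a = 2 * b
  · have hb : b ≠ 0 := by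
      rintro rfl
      exact hne (by linarith)
    obtain ⟨p₀, q₀, e, h', -⟩ := Representable.of_mul (a₀ := 1) (b₀ := 2) hb
      (by rw [mul_one, mul_comm b 2, ← h21]; exact Representable.map_symm_antiautomorphism he h)
    have := card_le_of_representable_one_two (by omega) h'
    omega
  · exact (four_lt_of_not_proportional hX hab h21 h).le

/-- The minimal representations for the distances `1, 2`, where `m = 3`. -/
theorem attains_one_two_iff_of_card_eq_three (hX : Fintype.card X = 3) (U : Finset (X × X))
    (hU : 2 * U.card ≤ Fintype.card (X × X)) (p q : ℕ) :
    (Representable (switching (hamming X) U) 1 2 p q ∧ p + q = 4) ↔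
      p = 4 ∧ q = 0 ∧ (U = ∅ ∨ IsUnionOfLines 1 U) := by
  have : Nonempty X := Fintype.card_pos_iff.mp (by omega)
  have hκ := finrank_ker_distOp_of_card_eq_three hX
  have hc : Fintype.card (X × X) = 9 := by rw [Fintype.card_prod, hX]
  have hsig : ∀ {s : ℕ}, IsUnionOfLines s U → ∀ {p q : ℕ},
      Representable (switching (hamming X) U) 1 2 p q → p + q = 4 → p = 4 ∧ q = 0 := by
    intro s hs p q h e
    have h1 := card_le_of_nonneg (by omega) hs h (by
      rw [hX]; push_cast; nlinarith [sq_nonneg ((3 : ℝ) - 2 * s)])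
    omega
  constructor
  · rintro ⟨h, e⟩
    obtain ⟨s, hs⟩ := isUnionOfLines_of_ker_le
      (ker_le_signPerp_of_representable (by omega) h (by omega))
    obtain ⟨rfl, rfl⟩ := hsig hs h e
    refine ⟨rfl, rfl, ?_⟩
    have h1 := hs.card_eq
    rw [hX] at h1
    obtain rfl | rfl : s = 0 ∨ s = 1 := by omega
    · exact Or.inl hs.eq_empty
    · exact Or.inr hs
  · rintro ⟨rfl, rfl, h⟩
    obtain ⟨s, hs⟩ : ∃ s, IsUnionOfLines s U := by
      rcases h with rfl | h
      · exact ⟨0, isUnionOfLines_empty⟩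
      · exact ⟨1, h⟩
    obtain ⟨p, q, hrep, e⟩ := exists_representable_one_two (by omega)
      (ker_le_signPerp (by omega) hs)
    obtain ⟨rfl, rfl⟩ := hsig hs hrep (by omega)
    exact ⟨hrep, rfl⟩

theorem isIndepSet_iff_isClique_map {V : Type*} {G : SimpleGraph V} {e : V ≃ V}
    (he : ∀ u v, u ≠ v → (G.Adj (e u) (e v) ↔ ¬G.Adj u v)) (U : Finset V) :
    G.IsIndepSet (U : Set V) ↔ G.IsClique ((U.map e.toEmbedding : Finset V) : Set V) := by
  constructor
  · intro h x hx y hy hxy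
    simp only [Finset.coe_map, Equiv.coe_toEmbedding, Set.mem_image, Finset.mem_coe] at hx hy
    obtain ⟨u, hu, rfl⟩ := hx
    obtain ⟨v, hv, rfl⟩ := hy
    have huv : u ≠ v := fun e => hxy (by rw [e])
    exact (he u v huv).mpr (h hu hv huv)
  · intro h u hu v hv huv
    exact (he u v huv).mp (h (by simpa using hu) (by simpa using hv) (e.injective.ne huv))

theorem attains_iff_of_card_eq_three (hX : Fintype.card X = 3) (U : Finset (X × X))
    (hU : 2 * U.card ≤ Fintype.card (X × X)) (a b : ℝ) (p q : ℕ) :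
    Attains (hamming X) U a b p q ↔
      (UpToScaling a b p q 1 2 4 0 ∧ (U = ∅ ∨ IsDelsarteClique (hamming X) U)) ∨
      (UpToScaling a b p q 2 1 4 0 ∧
        (U = ∅ ∨ ((hamming X).IsIndepSet (U : Set (X × X)) ∧ U.card = 3))) := by
  have hκ := finrank_ker_distOp_of_card_eq_three hX
  have hc : Fintype.card (X × X) = 9 := by rw [Fintype.card_prod, hX]
  have hmin := isMinDimensionality_of_card_eq_three hX
  obtain ⟨e, he, he'⟩ := exists_antiautomorphism hX
  have hU' : 2 * (U.map e.symm.toEmbedding).card ≤ Fintype.card (X × X) := by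
    rwa [Finset.card_map]
  have hcoclique : ((hamming X).IsIndepSet (U : Set (X × X)) ∧ U.card = 3) ↔
      IsUnionOfLines 1 (U.map e.symm.toEmbedding) := by
    rw [← isDelsarteClique_iff_isUnionOfLines (by omega),
      isDelsarteClique_hamming_iff (by omega), Finset.card_map, hX, isIndepSet_iff_isClique_map he']
  rw [isDelsarteClique_iff_isUnionOfLines (by omega), hcoclique]
  constructor
  · intro h
    have hpq := h.2.2.unique hmin
    by_cases h12 : b = 2 * a
    · obtain ⟨-, p₀, q₀, e, hrep, hs⟩ :=
        attains_one_two (d := 4) (by omega) (by omega) h12 h hmin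
      obtain ⟨rfl, rfl, h⟩ := (attains_one_two_iff_of_card_eq_three hX U hU p₀ q₀).mp ⟨hrep, e⟩
      exact Or.inl ⟨hs, h⟩
    by_cases h21 : a = 2 * b
    · have hb : b ≠ 0 := by
        rintro rfl
        exact h.1.1 (by linarith)
      obtain ⟨p₀, q₀, e, h', hs⟩ := Representable.of_mul (a₀ := 1) (b₀ := 2) hb
        (by
          rw [mul_one, mul_comm b 2, ← h21]
          exact Representable.map_symm_antiautomorphism he h.2.1)
      rw [mul_one, mul_comm b 2, ← h21] at hs
      obtain ⟨rfl, rfl, h⟩ := (attains_one_two_iff_of_card_eq_three hX _ hU' p₀ q₀).mp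
        ⟨h', by omega⟩
      rw [Finset.map_eq_empty] at h
      exact Or.inr ⟨hs.swap, h⟩
    · have := four_lt_of_not_proportional hX h12 h21 h.2.1
      omega
  · rintro (⟨hs, h⟩ | ⟨hs, h⟩)
    · have hrep := ((attains_one_two_iff_of_card_eq_three hX U hU 4 0).mpr ⟨rfl, rfl, h⟩).1
      exact attains_of_upToScaling (by omega) (by norm_num) (by norm_num) (by norm_num) hrep hmin hs
    · rw [← Finset.map_eq_empty (f := e.symm.toEmbedding)] at h
      have hrep := ((attains_one_two_iff_of_card_eq_three hX _ hU' 4 0).mpr ⟨rfl, rfl, h⟩).1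
      exact attains_of_upToScaling (by omega) (by norm_num) (by norm_num) (by norm_num)
        (hrep.map_antiautomorphism e.symm he') hmin hs

end CardThree

/-! ### The case `m = 2` -/

section CardTwo

open Classical in
/-- One of the two classes of the bipartite graph `H(2,2)`: the vertices with exactly one
coordinate equal to `o`. -/
def bipartClass (o : X) : Finset (X × X) :=
  Finset.univ.filter fun u => ¬(u.1 = o ↔ u.2 = o)

theorem mem_bipartClass {o : X} {u : X × X} : u ∈ bipartClass o ↔ ¬(u.1 = o ↔ u.2 = o) := by
  simp [bipartClass]

theorem eq_of_iff_of_card_eq_two (hX : Fintype.card X = 2) (o : X) {i j : X}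
    (h : i = o ↔ j = o) : i = j := by
  classical
  by_contra hij
  by_cases hi : i = o
  · exact hij (hi.trans (h.mp hi).symm)
  · have hj : j ≠ o := fun e => hi (h.mpr e)
    have h3 : ({i, j, o} : Finset X).card ≤ 2 := hX ▸ Finset.card_le_univ _
    rw [Finset.card_eq_three.mpr ⟨i, j, o, hij, hi, hj, rfl⟩] at h3
    omega

theorem hamming_adj_iff_of_card_eq_two (hX : Fintype.card X = 2) (o : X) (u v : X × X) :
    (hamming X).Adj u v ↔ ¬(u ∈ bipartClass o ↔ v ∈ bipartClass o) := by
  have h1 : u.1 = v.1 ↔ (u.1 = o ↔ v.1 = o) :=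
    ⟨fun e => by rw [e], eq_of_iff_of_card_eq_two hX o⟩
  have h2 : u.2 = v.2 ↔ (u.2 = o ↔ v.2 = o) :=
    ⟨fun e => by rw [e], eq_of_iff_of_card_eq_two hX o⟩
  have h : (hamming X).Adj u v ↔ (u.1 = v.1 ∧ ¬u.2 = v.2) ∨ (¬u.1 = v.1 ∧ u.2 = v.2) := Iff.rfl
  rw [h, h1, h2, mem_bipartClass, mem_bipartClass]
  by_cases u.1 = o <;> by_cases v.1 = o <;> by_cases u.2 = o <;> by_cases v.2 = o <;> simp [*]

theorem switching_adj_iff_of_card_eq_two (hX : Fintype.card X = 2) (o : X) (U : Finset (X × X))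
    (u v : X × X) : (switching (hamming X) U).Adj u v ↔
      ¬((u ∈ bipartClass o ↔ u ∈ U) ↔ (v ∈ bipartClass o ↔ v ∈ U)) := by
  rw [switching_adj, hamming_adj_iff_of_card_eq_two hX o]
  tauto

/-- Every graph in the switching class is complete bipartite or edgeless, so that the two classes
can be sent to two points of the line. -/
theorem representable_of_card_eq_two (hX : Fintype.card X = 2) (U : Finset (X × X)) :
    Representable (switching (hamming X) U) 1 0 1 0 := by
  classical
  have : Nonempty X := Fintype.card_pos_iff.mp (by omega)
  obtain ⟨o⟩ := this
  refine ⟨fun u _ => if (u ∈ bipartClass o ↔ u ∈ U) then 1 else 0, fun u v => ?_⟩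
  rw [dissimilarity_apply, switching_adj_iff_of_card_eq_two hX o]
  simp only [scalarSquare, form, Pi.sub_apply]
  by_cases huv : u = v
  · subst huv; simp
  · by_cases h1 : (u ∈ bipartClass o ↔ u ∈ U) <;> by_cases h2 : (v ∈ bipartClass o ↔ v ∈ U) <;>
      simp [h1, h2, huv]

theorem admissible_iff_exists_adj {V : Type*} (G : SimpleGraph V) {a : ℝ} (ha : a ≠ 0) :
    Admissible G a 0 ↔ ∃ u v, G.Adj u v := by
  constructor
  · intro h
    by_contra! hn
    refine h.2 ?_
    ext u v
    by_cases huv : u = v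
    · rw [huv, dissimilarity_self]; rfl
    · rw [dissimilarity_of_not_adj _ _ huv (hn u v)]; rfl
  · rintro ⟨u, v, h⟩
    refine ⟨ha, fun e => ?_⟩
    have := congrFun (congrFun e u) v
    rw [dissimilarity_of_adj _ _ h] at this
    exact ha this

theorem exists_switching_adj_iff (hX : Fintype.card X = 2) (U : Finset (X × X))
    (hU : 2 * U.card ≤ Fintype.card (X × X)) :
    (∃ u v, (switching (hamming X) U).Adj u v) ↔
      U = ∅ ∨ U.card = 1 ∨ ∃ u v, (hamming X).Adj u v ∧ ∀ w, w ∈ U ↔ w = u ∨ w = v := by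
  classical
  have : Nontrivial X := Fintype.one_lt_card_iff_nontrivial.mp (by omega)
  obtain ⟨o, i, hoi⟩ := exists_pair_ne X
  rw [Fintype.card_prod, hX] at hU
  constructor
  · rintro ⟨x, y, hxy⟩
    obtain h | h | h : U.card = 0 ∨ U.card = 1 ∨ U.card = 2 := by omega
    · exact Or.inl (Finset.card_eq_zero.mp h)
    · exact Or.inr (Or.inl h)
    · refine Or.inr (Or.inr ?_)
      obtain ⟨u, v, huv, rfl⟩ := Finset.card_eq_two.mp h
      refine ⟨u, v, ?_, fun w => by simp⟩
      by_contra hadj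
      rw [hamming_adj_iff_of_card_eq_two hX o, not_not] at hadj
      -- a class of the bipartition has only two vertices
      have hfst : ∀ {z w : X × X}, z ≠ w → (z ∈ bipartClass o ↔ w ∈ bipartClass o) →
          ¬(z.1 = o ↔ w.1 = o) := by
        intro z w hne h h1
        refine hne (Prod.ext (eq_of_iff_of_card_eq_two hX o h1)
          (eq_of_iff_of_card_eq_two hX o ?_))
        rw [mem_bipartClass, mem_bipartClass] at h
        tauto
      have hcl : ∀ w, w ∈ ({u, v} : Finset (X × X)) ↔
          (w ∈ bipartClass o ↔ u ∈ bipartClass o) := by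
        intro w
        rw [Finset.mem_insert, Finset.mem_singleton]
        constructor
        · rintro (rfl | rfl)
          · exact Iff.rfl
          · exact hadj.symm
        · intro hw
          by_contra! hn
          have h1 := hfst hn.1 hw
          have h2 := hfst hn.2 (hw.trans hadj)
          have h3 := hfst huv hadj
          tauto
      rw [switching_adj_iff_of_card_eq_two hX o, hcl, hcl] at hxy
      tauto
  · rintro (rfl | h | ⟨u, v, h, hU⟩)
    · refine ⟨(o, o), (o, i), ?_⟩
      rw [switching_adj_iff_of_card_eq_two hX o]
      simp [mem_bipartClass, hoi.symm]
    · obtain ⟨u, rfl⟩ := Finset.card_eq_one.mp h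
      -- the vertex that differs from `u` in both coordinates
      let σ : X → X := fun x => if x = o then i else o
      have hσ : ∀ x, σ x = o ↔ x ≠ o := by
        intro x
        by_cases hx : x = o <;> simp [σ, hx, hoi.symm]
      refine ⟨u, (σ u.1, σ u.2), ?_⟩
      have hne : (σ u.1, σ u.2) ≠ u := by
        intro e
        have h1 := hσ u.1
        rw [show σ u.1 = u.1 from congrArg Prod.fst e] at h1
        tauto
      rw [switching_adj_iff_of_card_eq_two hX o, mem_bipartClass, mem_bipartClass, hσ, hσ,
        Finset.mem_singleton, Finset.mem_singleton]
      tauto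
    · refine ⟨u, v, ?_⟩
      have hu := (hU u).mpr (Or.inl rfl)
      have hv := (hU v).mpr (Or.inr rfl)
      exact Or.inl ⟨iff_of_true hu hv, h⟩

theorem distOp_one_zero_of_card_eq_two (hX : Fintype.card X = 2) (o : X) (y : X × X → ℝ)
    (u : X × X) : distOp (hamming X) 1 0 y u =
      signVec (bipartClass o) u * ∑ v, signVec (bipartClass o) v * y v := by
  classical
  have h : ∀ v, signVec (bipartClass o) u * (signVec (bipartClass o) v * y v) =
      (if u = v then y v else 0) + seidel (hamming X) u v * y v := by
    intro v
    by_cases huv : u = v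
    · subst huv
      rw [← mul_assoc, signVec_mul_self]
      simp [seidel]
    · have hadj := hamming_adj_iff_of_card_eq_two hX o u v
      by_cases h1 : u ∈ bipartClass o <;> by_cases h2 : v ∈ bipartClass o <;>
        simp [seidel, signVec, hadj, huv, h1, h2]
  rw [Finset.mul_sum, distOp_apply]
  simp only [h, Finset.sum_add_distrib, Finset.sum_ite_eq, Finset.mem_univ, if_true]
  ring

theorem eq_zero_of_card_eq_two (hX : Fintype.card X = 2) {U : Finset (X × X)} {a b : ℝ} {p q : ℕ}
    (h : Representable (switching (hamming X) U) a b p q) (hpq : p + q = 1) : b = 0 := by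
  by_contra hb
  have : Nonempty X := Fintype.card_pos_iff.mp (by omega)
  obtain ⟨o⟩ := id this
  have hc : Fintype.card (X × X) = 4 := by rw [Fintype.card_prod, hX]
  have hle : signPerp (bipartClass o) ⊓ signPerp U ≤ rad (hamming X) U 1 0 := by
    refine le_trans (inf_le_inf_right _ fun y hy => ?_) (ker_inf_signPerp_le_rad _ _ _ _)
    rw [LinearMap.mem_ker]
    ext u
    rw [distOp_one_zero_of_card_eq_two hX o, mem_signPerp.mp hy, mul_zero, Pi.zero_apply]
  have h1 := finrank_add_le_of_disjoint (A := rad (hamming X) U a b)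
    (B := signPerp (bipartClass o) ⊓ signPerp U) (C := signPerp U)
    (disjoint_of_dotProduct fun x hx y hy =>
      dotProduct_eq_zero_of_mem_rad (by simpa using Ne.symm hb) hx (hle hy))
    (rad_le _ _ _ _) inf_le_right
  have h2 := h.finrank_signPerp_le
  have h3 := finrank_signPerp U
  have h4 := finrank_signPerp (bipartClass o)
  have h5 := finrank_le_finrank_inf_signPerp U (signPerp (bipartClass o))
  omega

theorem isMinDimensionality_of_card_eq_two (hX : Fintype.card X = 2) :
    IsMinDimensionality (hamming X) 1 := by
  constructor
  · refine ⟨_, ⟨∅, rfl⟩, 1, 0, 1, 0, ?_, representable_of_card_eq_two hX _, rfl⟩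
    rw [admissible_iff_exists_adj _ one_ne_zero, exists_switching_adj_iff hX _ (by simp)]
    exact Or.inl rfl
  · rintro n ⟨H, -, a, b, p, q, hadm, ⟨φ, hφ⟩, rfl⟩
    by_contra hlt
    obtain ⟨rfl, rfl⟩ : p = 0 ∧ q = 0 := by omega
    refine hadm.2 ?_
    ext u v
    rw [← hφ]
    simp [scalarSquare, form]

theorem attains_iff_of_card_eq_two (hX : Fintype.card X = 2) (U : Finset (X × X))
    (hU : 2 * U.card ≤ Fintype.card (X × X)) (a b : ℝ) (p q : ℕ) :
    Attains (hamming X) U a b p q ↔ UpToScaling a b p q 1 0 1 0 ∧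
      (U = ∅ ∨ U.card = 1 ∨ ∃ u v, (hamming X).Adj u v ∧ ∀ w, w ∈ U ↔ w = u ∨ w = v) := by
  have hmin := isMinDimensionality_of_card_eq_two hX
  rw [← exists_switching_adj_iff hX U hU]
  constructor
  · rintro ⟨hadm, hrep, hpq⟩
    have e := hpq.unique hmin
    obtain rfl := eq_zero_of_card_eq_two hX hrep e
    have ha : a ≠ 0 := hadm.1
    have hadj := (admissible_iff_exists_adj _ ha).mp hadm
    refine ⟨?_, hadj⟩
    obtain ⟨p₀, q₀, e', ⟨φ, hφ⟩, hs⟩ := Representable.of_mul (a₀ := 1) (b₀ := 0) ha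
      (by rwa [mul_one, mul_zero])
    rw [mul_one, mul_zero] at hs
    obtain ⟨u, v, huv⟩ := hadj
    have h1 := hφ u v
    rw [dissimilarity_of_adj _ _ huv] at h1
    obtain ⟨rfl, rfl⟩ | ⟨rfl, rfl⟩ : (p₀ = 1 ∧ q₀ = 0) ∨ (p₀ = 0 ∧ q₀ = 1) := by omega
    · exact hs
    · simp only [scalarSquare, form, Finset.univ_eq_empty, Finset.sum_empty] at h1
      have h2 : 0 ≤ ∑ j : Fin 1, (φ u - φ v) (Sum.inr j) * (φ u - φ v) (Sum.inr j) :=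
        Finset.sum_nonneg fun j _ => mul_self_nonneg _
      linarith
  · rintro ⟨hs, h⟩
    refine ⟨((admissible_iff_exists_adj _ one_ne_zero).mpr h).of_upToScaling hs,
      (representable_of_card_eq_two hX U).of_upToScaling hs, ?_⟩
    rwa [hs.add_eq]

end CardTwo

end

end PseudoEuclidean

end

open PseudoEuclidean in
theorem theorem4p3 {X : Type*} [Fintype X] (m : ℕ) (hX : Fintype.card X = m) (hm : 2 ≤ m) :
    -- the case `m = 2`
    (m = 2 →
      IsMinDimensionality (hamming X) 1 ∧
      ∀ U : Finset (X × X), 2 * U.card ≤ Fintype.card (X × X) → ∀ (a b : ℝ) (p q : ℕ),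
        (Attains (hamming X) U a b p q ↔
          UpToScaling a b p q 1 0 1 0 ∧
            (U = ∅ ∨ U.card = 1 ∨
              ∃ u v, (hamming X).Adj u v ∧ ∀ w, w ∈ U ↔ w = u ∨ w = v))) ∧
    -- the case `m = 3`
    (m = 3 →
      IsMinDimensionality (hamming X) 4 ∧
      ∀ U : Finset (X × X), 2 * U.card ≤ Fintype.card (X × X) → ∀ (a b : ℝ) (p q : ℕ),
        (Attains (hamming X) U a b p q ↔
          (UpToScaling a b p q 1 2 4 0 ∧ (U = ∅ ∨ IsDelsarteClique (hamming X) U)) ∨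
          (UpToScaling a b p q 2 1 4 0 ∧
            (U = ∅ ∨ ((hamming X).IsIndepSet (U : Set (X × X)) ∧ U.card = 3))))) ∧
    -- the case `m = 4`
    (m = 4 →
      IsMinDimensionality (hamming X) 5 ∧
      ∀ U : Finset (X × X), 2 * U.card ≤ Fintype.card (X × X) → ∀ (a b : ℝ) (p q : ℕ),
        (Attains (hamming X) U a b p q ↔
          UpToScaling a b p q 1 2 5 0 ∧
            IsDisjointUnionOfDelsarteCliques (hamming X) 2 U ∧ U.card = 2 * m)) ∧
    -- the case `m ≥ 5`
    (5 ≤ m →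
      IsMinDimensionality (hamming X) (2 * m - 2) ∧
      (∀ U : Finset (X × X), 2 * U.card ≤ Fintype.card (X × X) → ∀ (a b : ℝ) (p q : ℕ),
        (Attains (hamming X) U a b p q ↔
          ∃ s : ℕ, s ≤ m / 2 ∧ IsDisjointUnionOfDelsarteCliques (hamming X) s U ∧
            U.card = s * m ∧
            (((s : ℝ) < threshold m ∧ UpToScaling a b p q 1 2 (2 * m - 2) 0) ∨
              (threshold m < (s : ℝ) ∧ UpToScaling a b p q 1 2 (2 * m - 3) 1)))) ∧
      -- every `s ≤ ⌊m/2⌋` occurs, and so do both signatures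
      (∀ s : ℕ, s ≤ m / 2 → ∃ U : Finset (X × X),
        IsDisjointUnionOfDelsarteCliques (hamming X) s U) ∧
      (0 < threshold m ∧ threshold m < ((m / 2 : ℕ) : ℝ)) ∧
      -- the threshold is not an integer
      ∀ k : ℤ, threshold m ≠ (k : ℝ)) := by
  subst hX
  refine ⟨fun h => ⟨isMinDimensionality_of_card_eq_two h, attains_iff_of_card_eq_two h⟩,
    fun h => ⟨isMinDimensionality_of_card_eq_three h, attains_iff_of_card_eq_three h⟩,
    fun h => ⟨isMinDimensionality_of_card_eq_four h, fun U _ a b p q => ?_⟩,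
    fun h => ⟨isMinDimensionality_of_five_le h, fun U hU a b p q => ?_, fun s hs => ?_,
      ⟨threshold_pos h, threshold_lt_half h⟩, threshold_ne_int h⟩⟩
  · rw [attains_iff_of_card_eq_four h, isDisjointUnionOfDelsarteCliques_iff hm]
    exact and_congr_right fun _ => ⟨fun hU => ⟨hU, hU.card_eq⟩, fun hU => hU.1⟩
  · rw [attains_iff_of_five_le h U hU]
    refine exists_congr fun s => and_congr_right fun _ => ?_
    rw [isDisjointUnionOfDelsarteCliques_iff hm]
    exact ⟨fun ⟨hs, h⟩ => ⟨hs, hs.card_eq, h⟩, fun ⟨hs, _, h⟩ => ⟨hs, h⟩⟩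
  · obtain ⟨U, hU⟩ := exists_isUnionOfLines_of_le (X := X) (s := s) (by omega)
    exact ⟨U, (isDisjointUnionOfDelsarteCliques_iff hm s U).mpr hU⟩
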